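/- Let $\mathbb D$ be the open unit disc and $\mathbb T$ the unit circle. For a nonnegative Borel measure $\mu$ on $\mathbb T$ put $$\varphi_\mu(z)=\int_{\mathbb T}\frac{1-|z|^2}{|\zeta-z|^2}\,d\mu(\zeta)\qquad(z\in\mathbb D),$$ let $D(\mu)$ be the space of all $f$ in the Hardy space $H^2(\mathbb D)$ with $\int_{\mathbb D}|f'(z)|^2\varphi_\mu(z)\,dA(z)<\infty$, where $A$ is normalized area measure, and let $$M(D(\mu))=\{\phi\in D(\mu):\ \phi f\in D(\mu)\ \text{for all } f\in D(\mu)\}.$$ For an algebra $A$ of functions on $\mathbb D$, its maximal ideal space is the set of nonzero multiplicative linear functionals on $A$, with the topology of pointwise convergence on $A$ (the Gelfand, or weak*, topology). **Proposition 2.7.** Let $\mu$ be a nonnegative Borel measure on $\mathbb T$ and let $\zeta\in\mathbb T$ with $\mu(\{\zeta\})=0$. Suppose that the set of evaluations at points of $\mathbb D$ is dense in the maximal ideal space of $M(D(\mu))$. Let $H=M(D(\mu))\cap D(\delta_\zeta)$, where $\delta_\zeta$ is the unit point mass at $\zeta$. Then $H$ is an algebra under pointwise multiplication, and the set of evaluations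 at points of $\mathbb D$ is dense in the maximal ideal space of $H$. -/

import Mathlib

open MeasureTheory Complex

noncomputable section

namespace DirichletType

/-- The Borel σ-algebra on the unit circle `𝕋`. -/
instance circleMeasurableSpace : MeasurableSpace Circle := borel Circle

instance circleBorelSpace : BorelSpace Circle := ⟨rfl⟩

/-- Extension by zero to `ℂ` of a function on the open unit disc. -/
def extendZero (f : UnitDisc → ℂ) : ℂ → ℂ :=
  fun z => if h : ‖z‖ < 1 then f (UnitDisc.mk z h) else 0

/-- The function `f` is analytic (holomorphic) on the open unit disc. -/
def IsAnalytic (f : UnitDisc → ℂ) : Prop :=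
  DifferentiableOn ℂ (extendZero f) (Metric.ball 0 1)

/-- The complex derivative of `f`; it is used at points of the open disc only. -/
def derivative (f : UnitDisc → ℂ) : ℂ → ℂ := deriv (extendZero f)

/-- The function `f` belongs to the Hardy space `H²` of the disc: it is analytic and its
quadratic means over the circles `|z| = r < 1` are bounded. -/
def IsHardyTwo (f : UnitDisc → ℂ) : Prop :=
  IsAnalytic f ∧ ∃ C : ℝ, ∀ r ∈ Set.Ioo (0 : ℝ) 1,
    Real.circleAverage (fun z => ‖extendZero f z‖ ^ 2) 0 r ≤ C

/-- `φ_μ(z) = ∫_𝕋 (1 - |z|²) / |ζ - z|² dμ(ζ)`. -/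
def poissonWeight (μ : Measure Circle) (z : ℂ) : ENNReal :=
  ∫⁻ ζ : Circle, ENNReal.ofReal ((1 - ‖z‖ ^ 2) / ‖(ζ : ℂ) - z‖ ^ 2) ∂μ

/-- `∫_𝔻 |f'(z)|² φ_μ(z) dA(z)`, where `dA` is area measure divided by `π`. -/
def dirichletIntegral (μ : Measure Circle) (f : UnitDisc → ℂ) : ENNReal :=
  (ENNReal.ofReal Real.pi)⁻¹ *
    ∫⁻ z in Metric.ball (0 : ℂ) 1, ‖derivative f z‖ₑ ^ 2 * poissonWeight μ z

/-! ### Closure properties -/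

lemma extendZero_eq {f : UnitDisc → ℂ} {z : ℂ} (h : ‖z‖ < 1) :
    extendZero f z = f (UnitDisc.mk z h) := by
  simp [extendZero, h]

lemma extendZero_add (f g : UnitDisc → ℂ) :
    extendZero (f + g) = extendZero f + extendZero g := by
  funext z
  by_cases h : ‖z‖ < 1 <;> simp [extendZero, h]

lemma extendZero_smul (c : ℂ) (f : UnitDisc → ℂ) :
    extendZero (c • f) = c • extendZero f := by
  funext z
  by_cases h : ‖z‖ < 1 <;> simp [extendZero, h]

lemma extendZero_zero : extendZero 0 = 0 := by
  funext z
  by_cases h : ‖z‖ < 1 <;> simp [extendZero, h]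

lemma IsAnalytic.add {f g : UnitDisc → ℂ} (hf : IsAnalytic f) (hg : IsAnalytic g) :
    IsAnalytic (f + g) := by
  unfold IsAnalytic
  rw [extendZero_add]
  exact DifferentiableOn.add hf hg

lemma IsAnalytic.smul {f : UnitDisc → ℂ} (c : ℂ) (hf : IsAnalytic f) :
    IsAnalytic (c • f) := by
  unfold IsAnalytic
  rw [extendZero_smul]
  exact DifferentiableOn.const_smul hf c

lemma IsAnalytic.circleIntegrable {f : UnitDisc → ℂ} (hf : IsAnalytic f) {r : ℝ}
    (hr : r ∈ Set.Ioo (0 : ℝ) 1) :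
    CircleIntegrable (fun z => ‖extendZero f z‖ ^ 2) 0 r := by
  apply ContinuousOn.circleIntegrable hr.1.le
  apply ((DifferentiableOn.continuousOn hf).norm.pow 2).mono
  intro z hz
  simp only [mem_sphere_iff_norm, sub_zero] at hz
  simp [hz, hr.2]

lemma IsHardyTwo.add {f g : UnitDisc → ℂ} (hf : IsHardyTwo f) (hg : IsHardyTwo g) :
    IsHardyTwo (f + g) := by
  obtain ⟨hf, C, hC⟩ := hf
  obtain ⟨hg, D, hD⟩ := hg
  refine ⟨hf.add hg, 2 * C + 2 * D, fun r hr => ?_⟩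
  have h1 := hf.circleIntegrable hr
  have h2 := hg.circleIntegrable hr
  have h3 := (hf.add hg).circleIntegrable hr
  have key : Real.circleAverage (fun z => ‖extendZero (f + g) z‖ ^ 2) 0 r ≤
      Real.circleAverage ((2 : ℝ) • (fun z => ‖extendZero f z‖ ^ 2)
        + (2 : ℝ) • (fun z => ‖extendZero g z‖ ^ 2)) 0 r := by
    apply Real.circleAverage_mono h3
    · exact CircleIntegrable.add (h1.const_smul) (h2.const_smul)
    · intro z _
      have := norm_add_le (extendZero f z) (extendZero g z)
      have h0 := norm_nonneg (extendZero f z + extendZero g z)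
      simp only [extendZero_add, Pi.add_apply, Pi.smul_apply, smul_eq_mul]
      nlinarith [sq_nonneg (‖extendZero f z‖ - ‖extendZero g z‖)]
  rw [Real.circleAverage_add h1.const_smul h2.const_smul, Real.circleAverage_smul,
    Real.circleAverage_smul] at key
  have := hC r hr
  have := hD r hr
  simp only [smul_eq_mul] at key
  linarith

lemma IsHardyTwo.smul {f : UnitDisc → ℂ} (c : ℂ) (hf : IsHardyTwo f) :
    IsHardyTwo (c • f) := by
  obtain ⟨hf, C, hC⟩ := hf
  refine ⟨hf.smul c, ‖c‖ ^ 2 * C, fun r hr => ?_⟩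
  have : (fun z => ‖extendZero (c • f) z‖ ^ 2)
      = (‖c‖ ^ 2) • (fun z => ‖extendZero f z‖ ^ 2) := by
    funext z
    simp [extendZero_smul, mul_pow]
  rw [this, Real.circleAverage_smul, smul_eq_mul]
  exact mul_le_mul_of_nonneg_left (hC r hr) (by positivity)

lemma isHardyTwo_zero : IsHardyTwo 0 := by
  refine ⟨?_, 0, fun r _ => ?_⟩
  · unfold IsAnalytic
    rw [extendZero_zero]
    exact differentiableOn_const 0
  · simp [extendZero_zero, Real.circleAverage_const]

lemma measurable_poissonWeight (μ : Measure Circle) [IsFiniteMeasure μ] :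
    Measurable (poissonWeight μ) := by
  unfold poissonWeight
  apply Measurable.lintegral_prod_right'
    (f := fun p : ℂ × Circle => ENNReal.ofReal ((1 - ‖p.1‖ ^ 2) / ‖(p.2 : ℂ) - p.1‖ ^ 2))
  have h : Measurable (fun p : ℂ × Circle => (p.2 : ℂ)) :=
    (Continuous.measurable (by fun_prop : Continuous (fun w : Circle => (w : ℂ)))).comp
      measurable_snd
  have h' : Measurable (fun p : ℂ × Circle => p.1) := measurable_fst
  fun_prop

lemma poissonWeight_eq_top (μ : Measure Circle) (h : μ Set.univ = ⊤) {z : ℂ}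
    (hz : ‖z‖ < 1) : poissonWeight μ z = ⊤ := by
  have hpos : 0 < (1 - ‖z‖ ^ 2) / 4 := by nlinarith [norm_nonneg z]
  have : ∫⁻ _ : Circle, ENNReal.ofReal ((1 - ‖z‖ ^ 2) / 4) ∂μ ≤ poissonWeight μ z := by
    apply lintegral_mono
    intro ζ
    apply ENNReal.ofReal_le_ofReal
    have h1 : ‖(ζ : ℂ) - z‖ ≤ 2 := by
      have := norm_sub_le (ζ : ℂ) z
      have h3 : ‖(ζ : ℂ)‖ = 1 := Circle.norm_coe ζ
      linarith
    have h2 : 0 < ‖(ζ : ℂ) - z‖ := by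
      have := norm_sub_norm_le (ζ : ℂ) z
      have h3 : ‖(ζ : ℂ)‖ = 1 := Circle.norm_coe ζ
      linarith
    apply div_le_div_of_nonneg_left (by linarith) (by positivity)
    nlinarith
  rw [lintegral_const, h, ENNReal.mul_top (by simpa using hpos)] at this
  exact top_le_iff.1 this

lemma measurable_derivative (f : UnitDisc → ℂ) : Measurable (derivative f) :=
  measurable_deriv _

lemma aemeasurable_weighted (μ : Measure Circle) (f : UnitDisc → ℂ) :
    AEMeasurable (fun z => ‖derivative f z‖ₑ ^ 2 * poissonWeight μ z)
      (volume.restrict (Metric.ball (0 : ℂ) 1)) := by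
  have hd : Measurable (fun z => ‖derivative f z‖ₑ ^ 2) :=
    (measurable_derivative f).enorm.pow_const 2
  by_cases h : μ Set.univ = ⊤
  · refine ⟨fun z => ‖derivative f z‖ₑ ^ 2 * ⊤, hd.mul_const _, ?_⟩
    filter_upwards [ae_restrict_mem Metric.isOpen_ball.measurableSet] with z hz
    rw [poissonWeight_eq_top μ h (by simpa using hz)]
  · have : IsFiniteMeasure μ := ⟨lt_top_iff_ne_top.2 h⟩
    exact (hd.mul (measurable_poissonWeight μ)).aemeasurable

lemma derivative_add {f g : UnitDisc → ℂ} (hf : IsAnalytic f) (hg : IsAnalytic g) {z : ℂ}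
    (hz : z ∈ Metric.ball (0 : ℂ) 1) :
    derivative (f + g) z = derivative f z + derivative g z := by
  unfold derivative
  rw [extendZero_add]
  exact deriv_add (DifferentiableOn.differentiableAt hf (Metric.isOpen_ball.mem_nhds hz))
    (DifferentiableOn.differentiableAt hg (Metric.isOpen_ball.mem_nhds hz))

lemma enorm_add_sq_le (a b : ℂ) : ‖a + b‖ₑ ^ 2 ≤ 2 * ‖a‖ₑ ^ 2 + 2 * ‖b‖ₑ ^ 2 := by
  have h : ‖a + b‖₊ ^ 2 ≤ 2 * ‖a‖₊ ^ 2 + 2 * ‖b‖₊ ^ 2 := by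
    have h1 : ‖a + b‖ ^ 2 ≤ 2 * ‖a‖ ^ 2 + 2 * ‖b‖ ^ 2 := by
      have := norm_add_le a b
      have h0 := norm_nonneg (a + b)
      nlinarith [sq_nonneg (‖a‖ - ‖b‖)]
    exact_mod_cast h1
  simp only [enorm_eq_nnnorm]
  exact_mod_cast h

lemma dirichletIntegral_add_lt_top {μ : Measure Circle} {f g : UnitDisc → ℂ}
    (hf : IsAnalytic f) (hg : IsAnalytic g)
    (hfD : dirichletIntegral μ f < ⊤) (hgD : dirichletIntegral μ g < ⊤) :
    dirichletIntegral μ (f + g) < ⊤ := by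
  have key : dirichletIntegral μ (f + g) ≤
      2 * dirichletIntegral μ f + 2 * dirichletIntegral μ g := by
    unfold dirichletIntegral
    calc _ ≤ (ENNReal.ofReal Real.pi)⁻¹ * ∫⁻ z in Metric.ball (0 : ℂ) 1,
          (2 * (‖derivative f z‖ₑ ^ 2 * poissonWeight μ z)
            + 2 * (‖derivative g z‖ₑ ^ 2 * poissonWeight μ z)) := by
          apply mul_le_mul_right
          apply setLIntegral_mono' Metric.isOpen_ball.measurableSet
          intro z hz
          rw [derivative_add hf hg hz, ← mul_assoc, ← mul_assoc, ← add_mul]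
          gcongr
          exact enorm_add_sq_le _ _
      _ = _ := by
          rw [lintegral_add_left' ((aemeasurable_weighted μ f).const_mul 2),
            lintegral_const_mul' _ _ (by simp), lintegral_const_mul' _ _ (by simp)]
          ring
  refine key.trans_lt (ENNReal.add_lt_top.2 ⟨?_, ?_⟩)
  · exact ENNReal.mul_lt_top (by simp) hfD
  · exact ENNReal.mul_lt_top (by simp) hgD

lemma dirichletIntegral_smul_lt_top {μ : Measure Circle} {f : UnitDisc → ℂ} (c : ℂ)
    (hfD : dirichletIntegral μ f < ⊤) : dirichletIntegral μ (c • f) < ⊤ := by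
  have key : dirichletIntegral μ (c • f) = ‖c‖ₑ ^ 2 * dirichletIntegral μ f := by
    unfold dirichletIntegral
    have : ∀ z, ‖derivative (c • f) z‖ₑ ^ 2 * poissonWeight μ z
        = ‖c‖ₑ ^ 2 * (‖derivative f z‖ₑ ^ 2 * poissonWeight μ z) := by
      intro z
      have h : derivative (c • f) z = c * derivative f z := by
        unfold derivative
        rw [extendZero_smul, deriv_const_smul_field]
        rfl
      rw [h, enorm_mul, mul_pow, mul_assoc]
    simp_rw [this]
    rw [lintegral_const_mul' _ _ (by simp)]
    ring
  rw [key]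
  exact ENNReal.mul_lt_top (by simp) hfD

/-! ### The spaces and the maximal ideal space -/

/-- The Dirichlet type space `D(μ)`: all functions `f` in `H²` of the disc for which
`∫_𝔻 |f'|² φ_μ dA` is finite. -/
def dirichletSpace (μ : Measure Circle) : Submodule ℂ (UnitDisc → ℂ) where
  carrier := {f | IsHardyTwo f ∧ dirichletIntegral μ f < ⊤}
  add_mem' hf hg :=
    ⟨hf.1.add hg.1, dirichletIntegral_add_lt_top hf.1.1 hg.1.1 hf.2 hg.2⟩
  zero_mem' := ⟨isHardyTwo_zero, by simp [dirichletIntegral, derivative, extendZero_zero]⟩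
  smul_mem' c _ hf := ⟨hf.1.smul c, dirichletIntegral_smul_lt_top c hf.2⟩

/-- The multipliers `M(D(μ))`: all `φ ∈ D(μ)` with `φ f ∈ D(μ)` for every `f ∈ D(μ)`. -/
def multipliers (μ : Measure Circle) : Submodule ℂ (UnitDisc → ℂ) where
  carrier := {φ | φ ∈ dirichletSpace μ ∧ ∀ f ∈ dirichletSpace μ, φ * f ∈ dirichletSpace μ}
  add_mem' hφ hψ := ⟨add_mem hφ.1 hψ.1, fun f hf => by
    rw [add_mul]; exact add_mem (hφ.2 f hf) (hψ.2 f hf)⟩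
  zero_mem' := ⟨zero_mem _, fun f _ => by rw [zero_mul]; exact zero_mem _⟩
  smul_mem' c φ hφ := ⟨Submodule.smul_mem _ c hφ.1, fun f hf => by
    rw [smul_mul_assoc]; exact Submodule.smul_mem _ c (hφ.2 f hf)⟩

/-- The space `H = M(D(μ)) ∩ D(δ_ζ)`. -/
def multipliersAddPoint (μ : Measure Circle) (ζ : Circle) : Submodule ℂ (UnitDisc → ℂ) :=
  multipliers μ ⊓ dirichletSpace (Measure.dirac ζ)

/-- The maximal ideal space of an algebra `A` of functions on the disc: the nonzero
multiplicative linear functionals on `A`. (On a Banach algebra these are automatically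
continuous.) -/
def MaximalIdealSpace (A : Submodule ℂ (UnitDisc → ℂ)) : Type :=
  {m : A →ₗ[ℂ] ℂ // m ≠ 0 ∧
    ∀ f g h : A, (h : UnitDisc → ℂ) = (f : UnitDisc → ℂ) * (g : UnitDisc → ℂ) →
      m h = m f * m g}

/-- The Gelfand (weak-star) topology: pointwise convergence on `A`. -/
instance (A : Submodule ℂ (UnitDisc → ℂ)) : TopologicalSpace (MaximalIdealSpace A) :=
  TopologicalSpace.induced (fun m => (fun f : A => m.1 f)) inferInstance

/-- The elements of the maximal ideal space that are evaluations at points of the disc. -/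
def pointEvaluations (A : Submodule ℂ (UnitDisc → ℂ)) : Set (MaximalIdealSpace A) :=
  {m | ∃ z : UnitDisc, ∀ f : A, m.1 f = (f : UnitDisc → ℂ) z}

/-- The unit disc is dense in the maximal ideal space of `A`. -/
def DiscDense (A : Submodule ℂ (UnitDisc → ℂ)) : Prop :=
  Dense (pointEvaluations A)

end DirichletType

end

noncomputable section

namespace DirichletType

open Filter Topology Metric

/-! A function in D(δ_ζ) has the form f = c + (z - ζ)g with g in H², where c is its radial limit at
ζ (`exists_local_factor`). On H the map f ↦ c is a character. Its kernel I is an ideal not only of H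
but of all of M(D(μ)) (`mul_mem_multipliersAddPoint_of_vanishing`): if h = (z - ζ)G and φ is
bounded, the only new term in (φh)' is φ'(z - ζ)G. The factor z - ζ cancels the singularity of the
weight, and φ'G = (φG)' - φG' is square integrable against 1 - |z|² by Littlewood–Paley.

Let m be a character of H. If m kills I, then m(f) = c for every f, so m is the limit of the
evaluations at rζ as r → 1. Otherwise m(h) ≠ 0 for some h in I, and k(f) = m(hf)/m(h) is a character
of M(D(μ)) extending m (`exists_extension`). By hypothesis k is a limit of evaluations, hence so is
its restriction m.

That H is an algebra, and that I absorbs multipliers, both rest on the boundedness of multipliers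
(`exists_bound_of_mem_multipliers`), which comes from the closed graph theorem. The factorization
itself comes from Taylor coefficients and a Hardy inequality for tail sums. -/

/-! ### Taylor coefficients and Parseval's identity on circles. -/

/-- The Taylor coefficients at the origin. -/
def taylorCoeff (F : ℂ → ℂ) (n : ℕ) : ℂ := (n.factorial : ℂ)⁻¹ * iteratedDeriv n F 0

lemma hasSum_taylorCoeff {F : ℂ → ℂ} (hF : DifferentiableOn ℂ F (ball 0 1)) {z : ℂ}
    (hz : z ∈ ball (0 : ℂ) 1) : HasSum (fun n => taylorCoeff F n * z ^ n) (F z) := by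
  have h := Complex.hasSum_taylorSeries_on_ball hF hz
  have he : (fun n => taylorCoeff F n * z ^ n) =
      fun n : ℕ => (n.factorial : ℂ)⁻¹ • (z - 0) ^ n • iteratedDeriv n F 0 := by
    funext n
    rw [taylorCoeff, sub_zero, smul_eq_mul, smul_eq_mul]
    ring
  rwa [he]

lemma taylorCoeff_deriv (F : ℂ → ℂ) (n : ℕ) :
    taylorCoeff (deriv F) n = (n + 1) * taylorCoeff F (n + 1) := by
  have h : ((n : ℂ) + 1) ≠ 0 := Nat.cast_add_one_ne_zero n
  have h' : ((n.factorial : ℕ) : ℂ) ≠ 0 := Nat.cast_ne_zero.2 n.factorial_ne_zero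
  simp only [taylorCoeff, iteratedDeriv_succ', Nat.factorial_succ, Nat.cast_mul, Nat.cast_succ]
  field_simp

lemma hasFPowerSeriesAt_ofScalars {a : ℕ → ℂ} {F : ℂ → ℂ}
    (h : ∀ z ∈ ball (0 : ℂ) 1, HasSum (fun n => a n * z ^ n) (F z)) :
    HasFPowerSeriesAt F (FormalMultilinearSeries.ofScalars ℂ a) 0 := by
  rw [hasFPowerSeriesAt_iff]
  filter_upwards [ball_mem_nhds (0 : ℂ) one_pos] with z hz
  simpa [mul_comm] using h z hz

lemma eq_of_hasSum_pow {a b : ℕ → ℂ} {F : ℂ → ℂ}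
    (ha : ∀ z ∈ ball (0 : ℂ) 1, HasSum (fun n => a n * z ^ n) (F z))
    (hb : ∀ z ∈ ball (0 : ℂ) 1, HasSum (fun n => b n * z ^ n) (F z)) : a = b := by
  have := (hasFPowerSeriesAt_ofScalars ha).eq_formalMultilinearSeries
    (hasFPowerSeriesAt_ofScalars hb)
  funext n
  simpa using congrArg (fun p => FormalMultilinearSeries.coeff p n) this

lemma summable_norm_mul_pow {a : ℕ → ℂ} {F : ℂ → ℂ}
    (h : ∀ z ∈ ball (0 : ℂ) 1, HasSum (fun n => a n * z ^ n) (F z)) {r : ℝ} (h0 : 0 ≤ r)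
    (h1 : r < 1) : Summable (fun n => ‖a n‖ * r ^ n) := by
  have := (h r (by simpa [abs_of_nonneg h0] using h1)).summable.norm
  simpa [abs_of_nonneg h0] using this

lemma circleAverage_polynomial (a : ℕ → ℂ) (N : ℕ) {r : ℝ} (hr : 0 ≤ r) :
    Real.circleAverage (fun z => ‖∑ n ∈ Finset.range N, a n * z ^ n‖ ^ 2) 0 r =
      ∑ n ∈ Finset.range N, ‖a n‖ ^ 2 * r ^ (2 * n) := by
  -- The radius is absorbed into the coefficients, so that the identity on the unit circle applies.
  set p : Polynomial ℂ := ∑ n ∈ Finset.range N, Polynomial.monomial n (a n * (r : ℂ) ^ n) with hp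
  have hc : ∀ n, p.coeff n = if n < N then a n * (r : ℂ) ^ n else 0 := by
    intro n
    simp [hp, Polynomial.coeff_monomial]
  have h := Polynomial.sum_sq_norm_coeff_eq_circleAverage p
  have h1 : ∑ i ∈ p.support, ‖p.coeff i‖ ^ 2 =
      ∑ n ∈ Finset.range N, ‖a n‖ ^ 2 * r ^ (2 * n) := by
    rw [Finset.sum_subset (s₂ := Finset.range N)]
    · apply Finset.sum_congr rfl
      intro n hn
      rw [hc, if_pos (Finset.mem_range.1 hn)]
      simp [abs_of_nonneg hr, mul_pow, ← pow_mul, mul_comm]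
    · intro n hn
      rw [Polynomial.mem_support_iff, hc] at hn
      by_contra hh
      simp_all
    · intro n _ hn
      rw [Polynomial.mem_support_iff, not_not] at hn
      simp [hn]
  rw [← h1, h]
  simp only [Real.circleAverage_def]
  congr 2
  funext θ
  congr 2
  simp only [hp, Polynomial.eval_finsetSum, Polynomial.eval_monomial, circleMap]
  apply Finset.sum_congr rfl
  intro n _
  simp [mul_pow]
  ring

/-- Parseval's identity on the circle of radius `r`. -/
lemma hasSum_circleAverage {a : ℕ → ℂ} {F : ℂ → ℂ}
    (h : ∀ z ∈ ball (0 : ℂ) 1, HasSum (fun n => a n * z ^ n) (F z)) {r : ℝ} (h0 : 0 ≤ r)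
    (h1 : r < 1) :
    HasSum (fun n => ‖a n‖ ^ 2 * r ^ (2 * n))
      (Real.circleAverage (fun z => ‖F z‖ ^ 2) 0 r) := by
  have hs := summable_norm_mul_pow h h0 h1
  rw [hasSum_iff_tendsto_nat_of_nonneg (fun n => by positivity)]
  simp_rw [← circleAverage_polynomial a _ h0, Real.circleAverage_def]
  apply Tendsto.const_smul
  -- On the circle of radius r every partial sum is bounded by ∑ ‖a n‖ r ^ n.
  apply intervalIntegral.tendsto_integral_filter_of_dominated_convergence
    (fun _ => (∑' n, ‖a n‖ * r ^ n) ^ 2)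
  · refine .of_forall fun N => Continuous.aestronglyMeasurable ?_
    fun_prop
  · refine .of_forall fun N => .of_forall fun θ _ => ?_
    rw [Real.norm_of_nonneg (by positivity)]
    gcongr
    refine (norm_sum_le _ _).trans ?_
    refine le_trans (le_of_eq ?_) (hs.sum_le_tsum (Finset.range N) (fun n _ => by positivity))
    simp [circleMap, abs_of_nonneg h0]
  · exact intervalIntegrable_const
  · refine .of_forall fun θ _ => ?_
    have := (h (circleMap 0 r θ) (by simpa [circleMap, abs_of_nonneg h0] using h1))
    exact (this.tendsto_sum_nat.norm.pow 2)

/-- Each finite part of Parseval's sum is at most C for r < 1; letting r → 1 keeps the bound. -/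
lemma summable_of_circleAverage_le {a : ℕ → ℂ} {F : ℂ → ℂ}
    (h : ∀ z ∈ ball (0 : ℂ) 1, HasSum (fun n => a n * z ^ n) (F z)) {C : ℝ}
    (hC : ∀ r ∈ Set.Ioo (0 : ℝ) 1, Real.circleAverage (fun z => ‖F z‖ ^ 2) 0 r ≤ C) :
    Summable (fun n => ‖a n‖ ^ 2) := by
  refine summable_of_sum_le (c := C) (fun n => by positivity) fun s => ?_
  have ht : Tendsto (fun r : ℝ => ∑ n ∈ s, ‖a n‖ ^ 2 * r ^ (2 * n)) (𝓝[<] 1)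
      (𝓝 (∑ n ∈ s, ‖a n‖ ^ 2 * 1 ^ (2 * n))) := by
    apply Tendsto.mono_left _ nhdsWithin_le_nhds
    apply Continuous.tendsto (f := fun r : ℝ => ∑ n ∈ s, ‖a n‖ ^ 2 * r ^ (2 * n))
    fun_prop
  simp only [one_pow, mul_one] at ht
  refine le_of_tendsto ht ?_
  filter_upwards [Ioo_mem_nhdsLT (zero_lt_one' ℝ)] with r hr
  refine le_trans ?_ (hC r hr)
  exact sum_le_hasSum s (fun n _ => mul_nonneg (by positivity) (pow_nonneg hr.1.le _))
    (hasSum_circleAverage h hr.1.le hr.2)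

lemma circleAverage_le_of_summable {a : ℕ → ℂ} {F : ℂ → ℂ}
    (h : ∀ z ∈ ball (0 : ℂ) 1, HasSum (fun n => a n * z ^ n) (F z))
    (ha : Summable (fun n => ‖a n‖ ^ 2)) {r : ℝ} (hr : r ∈ Set.Ioo (0 : ℝ) 1) :
    Real.circleAverage (fun z => ‖F z‖ ^ 2) 0 r ≤ ∑' n, ‖a n‖ ^ 2 :=
  hasSum_le (fun n => mul_le_of_le_one_right (by positivity) (pow_le_one₀ hr.1.le hr.2.le))
    (hasSum_circleAverage h hr.1.le hr.2) ha.hasSum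

lemma differentiableOn_tsum_pow {a : ℕ → ℂ} {C : ℝ} (ha : ∀ n, ‖a n‖ ≤ C) :
    DifferentiableOn ℂ (fun z => ∑' n, a n * z ^ n) (ball 0 1) := by
  set p := FormalMultilinearSeries.ofScalars ℂ a
  have h1 : ((1 : NNReal) : ENNReal) ≤ p.radius := by
    refine p.le_radius_of_bound C fun n => ?_
    rw [FormalMultilinearSeries.ofScalars_norm]
    simpa using ha n
  have h2 := (p.hasFPowerSeriesOnBall (lt_of_lt_of_le (by simp) h1)).differentiableOn
  refine (h2.mono fun z hz => ?_).congr fun z hz => ?_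
  · refine Metric.eball_subset_eball h1 ?_
    rw [Metric.eball_coe]
    simpa using hz
  · simp [p, FormalMultilinearSeries.sum, mul_comm]

lemma summable_mul_pow {a : ℕ → ℂ} {C : ℝ} (ha : ∀ n, ‖a n‖ ≤ C) {z : ℂ}
    (hz : z ∈ ball (0 : ℂ) 1) : Summable (fun n => a n * z ^ n) := by
  have hz' : ‖z‖ < 1 := by simpa using hz
  refine Summable.of_norm_bounded (g := fun n => C * ‖z‖ ^ n)
    ((summable_geometric_of_lt_one (norm_nonneg z) hz').mul_left C) fun n => ?_
  rw [norm_mul, norm_pow]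
  gcongr
  exact ha n

/-! ### Area integrals with weight 1 - |z|² in terms of coefficients. -/

lemma lintegral_circle {F : ℂ → ℂ} (hF : ContinuousOn F (ball 0 1)) {r : ℝ}
    (h0 : 0 ≤ r) (h1 : r < 1) :
    ∫⁻ θ in Set.Ioo (-Real.pi) Real.pi, ‖F (circleMap 0 r θ)‖ₑ ^ 2 =
      ENNReal.ofReal (2 * Real.pi * Real.circleAverage (fun z => ‖F z‖ ^ 2) 0 r) := by
  have hc : Continuous (fun θ => F (circleMap 0 r θ)) :=
    hF.comp_continuous (continuous_circleMap 0 r)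
      (fun θ => by simpa [circleMap, abs_of_nonneg h0] using h1)
  have hi : IntegrableOn (fun θ => ‖F (circleMap 0 r θ)‖ ^ 2)
      (Set.Ioo (-Real.pi) Real.pi) :=
    ((hc.norm.pow 2).integrableOn_Icc).mono_set Set.Ioo_subset_Icc_self
  have h2 : 2 * Real.pi * Real.circleAverage (fun z => ‖F z‖ ^ 2) 0 r =
      ∫ θ in Set.Ioo (-Real.pi) Real.pi, ‖F (circleMap 0 r θ)‖ ^ 2 := by
    -- The average is moved from (0, 2π) to (-π, π), the angular range of `polarCoord`.
    rw [Real.circleAverage_eq_integral_add (-Real.pi),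
      intervalIntegral.integral_comp_add_right (fun θ => ‖F (circleMap 0 r θ)‖ ^ 2),
      smul_eq_mul, mul_inv_cancel_left₀ (by positivity),
      intervalIntegral.integral_of_le (by linarith [Real.pi_pos]), integral_Ioc_eq_integral_Ioo]
    congr 3
    · ring
    · ring
  rw [h2, ofReal_integral_eq_lintegral_ofReal hi (.of_forall fun θ => by positivity)]
  apply lintegral_congr
  intro θ
  rw [ENNReal.ofReal_pow (norm_nonneg _), ofReal_norm]

lemma lintegral_radial (n : ℕ) :
    ∫⁻ r in Set.Ioo (0 : ℝ) 1, ENNReal.ofReal (r ^ (2 * n + 1) * (1 - r ^ 2)) =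
      ENNReal.ofReal (1 / (2 * ((n + 1) * (n + 2)))) := by
  have hc : Continuous (fun r : ℝ => r ^ (2 * n + 1) * (1 - r ^ 2)) := by fun_prop
  rw [← ofReal_integral_eq_lintegral_ofReal]
  · congr 1
    rw [← integral_Ioc_eq_integral_Ioo, ← intervalIntegral.integral_of_le zero_le_one]
    have : ∀ r : ℝ, r ^ (2 * n + 1) * (1 - r ^ 2) = r ^ (2 * n + 1) - r ^ (2 * n + 3) := by
      intro r; ring
    simp_rw [this]
    rw [intervalIntegral.integral_sub (by simp) (by simp), integral_pow, integral_pow]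
    simp
    field_simp
    ring
  · exact (hc.integrableOn_Icc).mono_set Set.Ioo_subset_Icc_self
  · filter_upwards [ae_restrict_mem measurableSet_Ioo] with r hr
    have : 0 < r := hr.1
    have : 0 ≤ 1 - r ^ 2 := by nlinarith [hr.1, hr.2]
    positivity

lemma lintegral_ball_polar (G : ℂ → ENNReal) :
    ∫⁻ z in ball (0 : ℂ) 1, G z =
      ∫⁻ p in Set.Ioo (0 : ℝ) 1 ×ˢ Set.Ioo (-Real.pi) Real.pi,
        ENNReal.ofReal p.1 * G (circleMap 0 p.1 p.2) := by
  rw [← lintegral_indicator isOpen_ball.measurableSet,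
    ← Complex.lintegral_comp_polarCoord_symm]
  have hsub : Set.Ioo (0 : ℝ) 1 ×ˢ Set.Ioo (-Real.pi) Real.pi =
      polarCoord.target ∩ (Set.Iio (1 : ℝ) ×ˢ Set.univ) := by
    ext p
    simp [polarCoord]
    tauto
  rw [hsub, Set.inter_comm, ← setLIntegral_indicator (by measurability)]
  apply setLIntegral_congr_fun polarCoord.open_target.measurableSet
  intro p hp
  have hp0 : 0 < p.1 := hp.1
  have he : Complex.polarCoord.symm p = circleMap 0 p.1 p.2 := by
    rw [Complex.polarCoord_symm_apply, circleMap, ← Complex.cos_add_sin_I]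
    simp
  have hn : circleMap 0 p.1 p.2 ∈ ball (0 : ℂ) 1 ↔ p.1 < 1 := by
    simp [circleMap, abs_of_pos hp0]
  simp only [he, smul_eq_mul]
  by_cases h : p.1 < 1
  · rw [Set.indicator_of_mem (hn.2 h), Set.indicator_of_mem (by simpa using h)]
  · rw [Set.indicator_of_notMem (fun h' => h (hn.1 h')), Set.indicator_of_notMem (by simpa using h),
      mul_zero]

/-- The norm in the weighted Bergman space with weight `1 - |z|²`. -/
lemma lintegral_bergman {a : ℕ → ℂ} {F : ℂ → ℂ} (hF : DifferentiableOn ℂ F (ball 0 1))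
    (h : ∀ z ∈ ball (0 : ℂ) 1, HasSum (fun n => a n * z ^ n) (F z)) :
    ∫⁻ z in ball (0 : ℂ) 1, ‖F z‖ₑ ^ 2 * ENNReal.ofReal (1 - ‖z‖ ^ 2) =
      ENNReal.ofReal Real.pi * ∑' n : ℕ, ENNReal.ofReal (‖a n‖ ^ 2 / ((n + 1) * (n + 2))) := by
  rw [lintegral_ball_polar, Measure.volume_eq_prod, ← Measure.prod_restrict, lintegral_prod]
  swap
  · rw [Measure.prod_restrict]
    have hcm : Continuous (fun p : ℝ × ℝ => circleMap 0 p.1 p.2) := by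
      unfold circleMap; fun_prop
    have hFc : ContinuousOn (fun p : ℝ × ℝ => F (circleMap 0 p.1 p.2))
        (Set.Ioo (0 : ℝ) 1 ×ˢ Set.Ioo (-Real.pi) Real.pi) := by
      refine hF.continuousOn.comp hcm.continuousOn fun p hp => ?_
      simpa [circleMap, abs_of_pos hp.1.1] using hp.1.2
    have hm := hFc.aemeasurable (μ := volume) (measurableSet_Ioo.prod measurableSet_Ioo)
    exact AEMeasurable.mul (by fun_prop)
      ((hm.enorm.pow_const 2).mul (hcm.measurable.norm.pow_const 2 |>.const_sub 1
        |>.ennreal_ofReal.aemeasurable))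
  -- Parseval on each circle turns the angular integral into a series; what remains is a radial
  -- integral for each n.
  have key : ∀ r ∈ Set.Ioo (0 : ℝ) 1,
      ∫⁻ θ in Set.Ioo (-Real.pi) Real.pi, ENNReal.ofReal r *
        (‖F (circleMap 0 r θ)‖ₑ ^ 2 * ENNReal.ofReal (1 - ‖circleMap 0 r θ‖ ^ 2)) =
      ∑' n : ℕ, ENNReal.ofReal (2 * Real.pi * ‖a n‖ ^ 2) *
        ENNReal.ofReal (r ^ (2 * n + 1) * (1 - r ^ 2)) := by
    intro r hr
    have hr2 : 0 ≤ 1 - r ^ 2 := by nlinarith [hr.1, hr.2]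
    have hr0 : 0 < r := hr.1
    have e1 : ∀ θ, ENNReal.ofReal r *
        (‖F (circleMap 0 r θ)‖ₑ ^ 2 * ENNReal.ofReal (1 - ‖circleMap 0 r θ‖ ^ 2)) =
        ENNReal.ofReal (r * (1 - r ^ 2)) * ‖F (circleMap 0 r θ)‖ₑ ^ 2 := by
      intro θ
      rw [ENNReal.ofReal_mul hr.1.le]
      simp only [norm_circleMap_zero, sq_abs]
      ring
    simp_rw [e1]
    rw [lintegral_const_mul' _ _ ENNReal.ofReal_ne_top,
      lintegral_circle hF.continuousOn hr.1.le hr.2, ← ENNReal.ofReal_mul (by positivity)]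
    have hs := hasSum_circleAverage h hr.1.le hr.2
    have hs' := (hs.mul_left (2 * Real.pi)).mul_left (r * (1 - r ^ 2))
    rw [← hs'.tsum_eq, ENNReal.ofReal_tsum_of_nonneg (fun n => by positivity) hs'.summable]
    congr 1
    funext n
    rw [← ENNReal.ofReal_mul (by positivity)]
    congr 1
    ring
  rw [setLIntegral_congr_fun measurableSet_Ioo key, lintegral_tsum]
  · rw [← ENNReal.tsum_mul_left]
    congr 1
    funext n
    rw [lintegral_const_mul' _ _ ENNReal.ofReal_ne_top, lintegral_radial,
      ← ENNReal.ofReal_mul (by positivity), ← ENNReal.ofReal_mul (by positivity)]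
    congr 1
    field_simp
  · intro n
    exact Measurable.aemeasurable (by fun_prop)

lemma lintegral_bergman_lt_top_iff {a : ℕ → ℂ} {F : ℂ → ℂ}
    (hF : DifferentiableOn ℂ F (ball 0 1))
    (h : ∀ z ∈ ball (0 : ℂ) 1, HasSum (fun n => a n * z ^ n) (F z)) :
    ∫⁻ z in ball (0 : ℂ) 1, ‖F z‖ₑ ^ 2 * ENNReal.ofReal (1 - ‖z‖ ^ 2) < ⊤ ↔
      Summable (fun n : ℕ => ‖a n‖ ^ 2 / ((n + 1) * (n + 2) : ℝ)) := by
  rw [lintegral_bergman hF h]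
  constructor
  · intro h1
    have h2 : ∑' n : ℕ, ENNReal.ofReal (‖a n‖ ^ 2 / ((n + 1) * (n + 2))) ≠ ⊤ := by
      intro h3
      rw [h3, ENNReal.mul_top (by simpa using Real.pi_pos)] at h1
      exact lt_irrefl _ h1
    have := ENNReal.summable_toReal h2
    refine this.congr fun n => ?_
    rw [ENNReal.toReal_ofReal (by positivity)]
  · intro h1
    rw [← ENNReal.ofReal_tsum_of_nonneg (fun n => by positivity) h1]
    exact ENNReal.mul_lt_top ENNReal.ofReal_lt_top ENNReal.ofReal_lt_top

/-- The easy half of the Littlewood–Paley theorem. -/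
lemma lintegral_deriv_lt_top {a : ℕ → ℂ} {F : ℂ → ℂ} (hF : DifferentiableOn ℂ F (ball 0 1))
    (h : ∀ z ∈ ball (0 : ℂ) 1, HasSum (fun n => a n * z ^ n) (F z))
    (ha : Summable (fun n => ‖a n‖ ^ 2)) :
    ∫⁻ z in ball (0 : ℂ) 1, ‖deriv F z‖ₑ ^ 2 * ENNReal.ofReal (1 - ‖z‖ ^ 2) < ⊤ := by
  have ha' : a = taylorCoeff F := eq_of_hasSum_pow h fun z hz => hasSum_taylorCoeff hF hz
  have hd : DifferentiableOn ℂ (deriv F) (ball 0 1) := hF.deriv isOpen_ball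
  rw [lintegral_bergman_lt_top_iff hd fun z hz => hasSum_taylorCoeff hd hz]
  refine Summable.of_nonneg_of_le (fun n => by positivity) (fun n => ?_)
    ((summable_nat_add_iff 1).2 ha)
  -- The n-th term is (n + 1)/(n + 2) times ‖a (n + 1)‖².
  rw [taylorCoeff_deriv, ha', norm_mul, div_le_iff₀ (by positivity)]
  have : ‖(n : ℂ) + 1‖ = n + 1 := by
    rw [← Nat.cast_succ, Complex.norm_natCast]; simp
  rw [this]
  have : 0 ≤ ‖taylorCoeff F (n + 1)‖ ^ 2 := by positivity
  nlinarith [mul_nonneg this (by positivity : (0 : ℝ) ≤ n + 1)]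

/-! ### Hardy's inequality for tail sums -/

/-- Summation by parts: with T k the tail, k (T k)² telescopes to zero, and its increment is T² -
2Tx + x²/(k + 1). The termwise bound T² - 4x² ≤ 2 (increment) amounts to (T - 2x)² ≥ 0. -/
lemma sum_sq_tail_le (x : ℕ → ℝ) (K : ℕ) :
    ∑ k ∈ Finset.range K, (∑ n ∈ Finset.Ico k K, x n / (n + 1)) ^ 2 ≤
      4 * ∑ k ∈ Finset.range K, x k ^ 2 := by
  set T : ℕ → ℝ := fun k => ∑ n ∈ Finset.Ico k K, x n / (n + 1) with hT
  have hrec : ∀ k < K, T k = x k / (k + 1) + T (k + 1) := fun k hk =>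
    Finset.sum_eq_sum_Ico_succ_bot hk _
  have htel := Finset.sum_range_sub (fun k : ℕ => (k : ℝ) * T k ^ 2) K
  have hTK : T K = 0 := by simp [hT]
  simp only [hTK] at htel
  have hle : ∑ k ∈ Finset.range K, (T k ^ 2 - 4 * x k ^ 2) ≤
      2 * ∑ k ∈ Finset.range K, (((k + 1 : ℕ) : ℝ) * T (k + 1) ^ 2 - (k : ℝ) * T k ^ 2) := by
    rw [Finset.mul_sum]
    apply Finset.sum_le_sum
    intro k hk
    have h1 : T (k + 1) = T k - x k / (k + 1) := by
      rw [hrec k (Finset.mem_range.1 hk)]; ring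
    have h2 : (((k + 1 : ℕ) : ℝ) * T (k + 1) ^ 2 - (k : ℝ) * T k ^ 2) =
        T k ^ 2 - 2 * T k * x k + x k ^ 2 / (k + 1) := by
      rw [h1]; push_cast; field_simp; ring
    have h3 : 0 ≤ x k ^ 2 / (k + 1) := by positivity
    rw [h2]
    nlinarith [sq_nonneg (T k - 2 * x k)]
  rw [htel, Finset.sum_sub_distrib, ← Finset.mul_sum] at hle
  simp only [ne_eq, OfNat.ofNat_ne_zero, not_false_eq_true, zero_pow, mul_zero, Nat.cast_zero,
    zero_mul, sub_zero] at hle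
  linarith

lemma summable_div_succ {x : ℕ → ℝ} (hx : Summable (fun n => x n ^ 2)) (h0 : ∀ n, 0 ≤ x n) :
    Summable (fun n => x n / ((n : ℝ) + 1)) := by
  have h1 : Summable (fun n : ℕ => 1 / ((n : ℝ) + 1) ^ 2) := by
    have := (summable_nat_add_iff 1).2 (Real.summable_one_div_nat_pow.2 one_lt_two)
    simpa using this
  refine Summable.of_nonneg_of_le (fun n => div_nonneg (h0 n) (by positivity)) (fun n => ?_)
    (hx.add h1)
  rw [div_eq_mul_one_div, ← one_div_pow]
  -- Arithmetic–geometric mean inequality for x n and 1 / (n + 1).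
  nlinarith [sq_nonneg (x n - 1 / ((n : ℝ) + 1)), sq_nonneg (x n), sq_nonneg (1 / ((n : ℝ) + 1))]

lemma summable_sq_tail {x : ℕ → ℝ} (hx : Summable (fun n => x n ^ 2)) (h0 : ∀ n, 0 ≤ x n) :
    Summable (fun k : ℕ => (∑' n : ℕ, x (n + k) / (((n + k : ℕ) : ℝ) + 1)) ^ 2) := by
  have hs := summable_div_succ hx h0
  refine summable_of_sum_range_le (c := 4 * ∑' n, x n ^ 2) (fun n => by positivity) fun N => ?_
  have ht : Tendsto (fun K => ∑ k ∈ Finset.range N, (∑ n ∈ Finset.Ico k K, x n / (n + 1)) ^ 2)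
      atTop (𝓝 (∑ k ∈ Finset.range N, (∑' n : ℕ, x (n + k) / (((n + k : ℕ) : ℝ) + 1)) ^ 2)) := by
    refine tendsto_finsetSum _ fun k _ => Tendsto.pow ?_ 2
    have h1 := ((summable_nat_add_iff k).2 hs).hasSum.tendsto_sum_nat
    have h2 := h1.comp (tendsto_sub_atTop_nat k)
    refine h2.congr fun K => ?_
    rw [Finset.sum_Ico_eq_sum_range]
    simp [add_comm]
  refine le_of_tendsto ht ?_
  filter_upwards [eventually_ge_atTop N] with K hK
  calc _ ≤ ∑ k ∈ Finset.range K, (∑ n ∈ Finset.Ico k K, x n / (n + 1)) ^ 2 :=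
        Finset.sum_le_sum_of_subset_of_nonneg (Finset.range_mono hK) fun _ _ _ => by positivity
    _ ≤ 4 * ∑ k ∈ Finset.range K, x k ^ 2 := sum_sq_tail_le x K
    _ ≤ _ := by
      gcongr
      exact hx.sum_le_tsum _ fun n _ => by positivity

/-- If `b_{n+1} = e_n - e_{n+1} - e_{n+1} / (n + 1)` with `e` square summable and `e_0 = 0`, then
`∑ b_n` converges, and its tails are square summable. -/
lemma exists_limit_of_differences {b e : ℕ → ℂ} (he : Summable (fun n => ‖e n‖ ^ 2))
    (h0 : e 0 = 0) (hb : ∀ n, b (n + 1) = e n - e (n + 1) - e (n + 1) / (n + 1)) :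
    ∃ c : ℂ, Tendsto (fun N => ∑ n ∈ Finset.range N, b n) atTop (𝓝 c) ∧
      Summable (fun N => ‖c - ∑ n ∈ Finset.range (N + 1), b n‖ ^ 2) := by
  have hx : Summable (fun n => ‖e (n + 1)‖ ^ 2) := (summable_nat_add_iff 1).2 he
  have hs := summable_div_succ hx (fun n => norm_nonneg _)
  have hnorm : ∀ n : ℕ, ‖e (n + 1) / ((n : ℂ) + 1)‖ = ‖e (n + 1)‖ / ((n : ℝ) + 1) := by
    intro n
    rw [norm_div, ← Nat.cast_succ, Complex.norm_natCast, Nat.cast_succ]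
  have hs' : Summable (fun n : ℕ => e (n + 1) / ((n : ℂ) + 1)) := by
    refine Summable.of_norm ?_
    simpa only [hnorm] using hs
  -- The differences e n - e (n + 1) telescope, so the limit must be b 0 - S, and each tail is e N
  -- minus a tail to which Hardy's inequality applies.
  have hpart : ∀ N, ∑ n ∈ Finset.range (N + 1), b n =
      b 0 - e N - ∑ n ∈ Finset.range N, e (n + 1) / ((n : ℂ) + 1) := by
    intro N
    induction N with
    | zero => simp [h0]
    | succ N ih => rw [Finset.sum_range_succ, ih, hb, Finset.sum_range_succ]; ring
  set S := ∑' n : ℕ, e (n + 1) / ((n : ℂ) + 1)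
  have htail : ∀ N, (b 0 - S) - ∑ n ∈ Finset.range (N + 1), b n =
      e N - ∑' n : ℕ, e (n + N + 1) / (((n + N : ℕ) : ℂ) + 1) := by
    intro N
    have h1 : _ = S := hs'.sum_add_tsum_nat_add N
    rw [hpart, ← h1]
    ring
  have hsum : Summable (fun N => ‖(b 0 - S) - ∑ n ∈ Finset.range (N + 1), b n‖ ^ 2) := by
    refine Summable.of_nonneg_of_le (fun N => by positivity) (fun N => ?_)
      ((he.mul_left 2).add ((summable_sq_tail hx (fun n => norm_nonneg _)).mul_left 2))
    rw [htail]
    have h1 : ‖∑' n : ℕ, e (n + N + 1) / (((n + N : ℕ) : ℂ) + 1)‖ ≤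
        ∑' n : ℕ, ‖e (n + N + 1)‖ / (((n + N : ℕ) : ℝ) + 1) := by
      refine (norm_tsum_le_tsum_norm ?_).trans (le_of_eq ?_)
      · simp only [hnorm]
        exact (summable_nat_add_iff N).2 hs
      · simp only [hnorm]
    have h2 := norm_sub_le (e N) (∑' n : ℕ, e (n + N + 1) / (((n + N : ℕ) : ℂ) + 1))
    have h3 := norm_nonneg (e N - ∑' n : ℕ, e (n + N + 1) / (((n + N : ℕ) : ℂ) + 1))
    nlinarith [sq_nonneg (‖e N‖ - ∑' n : ℕ, ‖e (n + N + 1)‖ / (((n + N : ℕ) : ℝ) + 1))]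
  refine ⟨b 0 - S, ?_, hsum⟩
  rw [← tendsto_add_atTop_iff_nat 1]
  have h1 := hsum.tendsto_atTop_zero
  have h2 : Tendsto (fun N => (b 0 - S) - ∑ n ∈ Finset.range (N + 1), b n) atTop (𝓝 0) := by
    rw [tendsto_zero_iff_norm_tendsto_zero]
    have := (Real.continuous_sqrt.tendsto 0).comp h1
    simpa [Function.comp_def, Real.sqrt_sq] using this
  simpa using h2.const_sub (b 0 - S)

/-! ### Local structure at a boundary point -/

lemma hasSum_of_eq {f g : ℕ → ℂ} {a b : ℂ} (h : HasSum f a) (hfg : ∀ n, f n = g n)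
    (hab : a = b) : HasSum g b := by
  obtain rfl : f = g := funext hfg
  rwa [← hab]

/-- The case n = 0 is split off because n - 1 truncates to 0 there. -/
lemma hasSum_sub_mul {γ : ℕ → ℂ} {G : ℂ → ℂ} (w : ℂ)
    (h : ∀ z ∈ ball (0 : ℂ) 1, HasSum (fun n => γ n * z ^ n) (G z)) {z : ℂ}
    (hz : z ∈ ball (0 : ℂ) 1) :
    HasSum (fun n => ((if n = 0 then 0 else γ (n - 1)) - w * γ n) * z ^ n) ((z - w) * G z) := by
  have h1 : HasSum (fun n => (if n = 0 then 0 else γ (n - 1)) * z ^ n) (z * G z) := by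
    rw [← hasSum_nat_add_iff' 1]
    simp only [Nat.add_eq_zero_iff, one_ne_zero, and_false, ↓reduceIte, Nat.add_sub_cancel,
      Finset.range_one, Finset.sum_singleton, zero_mul, sub_zero]
    refine hasSum_of_eq ((h z hz).mul_left z) (fun n => ?_) rfl
    ring
  exact hasSum_of_eq (h1.sub ((h z hz).mul_left w)) (fun n => by ring) (by ring)

lemma sub_ne_zero_of_mem_ball {w z : ℂ} (hw : ‖w‖ = 1) (hz : z ∈ ball (0 : ℂ) 1) :
    z - w ≠ 0 := by
  intro h
  rw [sub_eq_zero.1 h, mem_ball_zero_iff, hw] at hz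
  exact lt_irrefl _ hz

/-- Trades the singular weight (1 - |z|²)/|w - z|² for the radial weight 1 - |z|² by dividing the
function by z - w. -/
lemma enorm_div_sub_sq {w z : ℂ} (hz : z - w ≠ 0) (A : ℂ) (s : ℝ) :
    ‖A / (z - w)‖ₑ ^ 2 * ENNReal.ofReal s = ‖A‖ₑ ^ 2 * ENNReal.ofReal (s / ‖w - z‖ ^ 2) := by
  have hpos : 0 < ‖z - w‖ := norm_pos_iff.2 hz
  have e : ∀ B : ℂ, ‖B‖ₑ ^ 2 = ENNReal.ofReal (‖B‖ ^ 2) := fun B => by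
    rw [ENNReal.ofReal_pow (norm_nonneg _), ofReal_norm]
  rw [e, e, ← ENNReal.ofReal_mul (by positivity), ← ENNReal.ofReal_mul (by positivity),
    norm_div, norm_sub_rev w z]
  congr 1
  field_simp

/-- Structure of the functions with finite local Dirichlet integral: `f = c + (z - w) g` with
`g` in the Hardy space, and `f` has the radial limit `c` at `w`. -/
lemma exists_local_factor {F : ℂ → ℂ} (hF : DifferentiableOn ℂ F (ball 0 1)) {w : ℂ}
    (hw : ‖w‖ = 1)
    (hI : ∫⁻ z in ball (0 : ℂ) 1,
      ‖deriv F z‖ₑ ^ 2 * ENNReal.ofReal ((1 - ‖z‖ ^ 2) / ‖w - z‖ ^ 2) < ⊤) :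
    ∃ (c : ℂ) (G : ℂ → ℂ), DifferentiableOn ℂ G (ball 0 1) ∧
      Summable (fun n => ‖taylorCoeff G n‖ ^ 2) ∧
      (∀ z ∈ ball (0 : ℂ) 1, F z = c + (z - w) * G z) ∧
      Tendsto (fun r : ℝ => F (r * w)) (𝓝[<] 1) (𝓝 c) := by
  -- Finiteness of the local integral says that U lies in the Bergman space with weight 1 - |z|²,
  -- which bounds its coefficients.
  set U : ℂ → ℂ := fun z => deriv F z / (z - w) with hU
  have hd : DifferentiableOn ℂ (deriv F) (ball 0 1) := hF.deriv isOpen_ball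
  have hUd : DifferentiableOn ℂ U (ball 0 1) :=
    hd.div (by fun_prop) fun z hz => sub_ne_zero_of_mem_ball hw hz
  have hUs : Summable (fun n : ℕ => ‖taylorCoeff U n‖ ^ 2 / ((n + 1) * (n + 2) : ℝ)) := by
    rw [← lintegral_bergman_lt_top_iff hUd fun z hz => hasSum_taylorCoeff hUd hz]
    refine lt_of_eq_of_lt ?_ hI
    refine setLIntegral_congr_fun isOpen_ball.measurableSet fun z hz => ?_
    exact enorm_div_sub_sq (sub_ne_zero_of_mem_ball hw hz) _ _
  have hcoef : ∀ n : ℕ, ((n : ℂ) + 1) * taylorCoeff F (n + 1) =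
      (if n = 0 then 0 else taylorCoeff U (n - 1)) - w * taylorCoeff U n := by
    intro n
    rw [← taylorCoeff_deriv]
    refine congrFun (eq_of_hasSum_pow (F := deriv F)
      (b := fun n => (if n = 0 then 0 else taylorCoeff U (n - 1)) - w * taylorCoeff U n)
      (fun z hz => hasSum_taylorCoeff hd hz) fun z hz => ?_) n
    have := hasSum_sub_mul w (fun z hz => hasSum_taylorCoeff hUd hz) hz
    rwa [hU, mul_div_cancel₀ _ (sub_ne_zero_of_mem_ball hw hz)] at this
  -- Chosen so that F' = (z - w)U reads b (n + 1) = e n - e (n + 1) - e (n + 1)/(n + 1) for b n =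
  -- `taylorCoeff F n` * w ^ n; the last term corrects the denominator n + 2 to n + 1.
  set e : ℕ → ℂ := fun n => if n = 0 then 0 else w ^ (n + 1) * taylorCoeff U (n - 1) / (n + 1)
    with he
  have hes : Summable (fun n => ‖e n‖ ^ 2) := by
    rw [← summable_nat_add_iff 1]
    refine Summable.of_nonneg_of_le (fun n => by positivity) (fun n => ?_) hUs
    have h2 : ‖((n : ℂ) + 1 + 1)‖ = n + 2 := by
      have : ((n : ℂ) + 1 + 1) = ((n + 2 : ℕ) : ℂ) := by push_cast; ring
      rw [this, Complex.norm_natCast]; push_cast; ring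
    simp only [he, Nat.add_eq_zero_iff, one_ne_zero, and_false, ↓reduceIte, Nat.add_sub_cancel,
      norm_div, norm_mul, norm_pow, hw, one_pow, one_mul, Nat.cast_add, Nat.cast_one, h2, div_pow]
    apply div_le_div_of_nonneg_left (by positivity) (by positivity)
    nlinarith
  obtain ⟨c, hc, hcs⟩ := exists_limit_of_differences (b := fun n => taylorCoeff F n * w ^ n) hes
    (by simp [he]) (by
      intro n
      have hn : ((n : ℂ) + 1) ≠ 0 := Nat.cast_add_one_ne_zero n
      have hn2 : ((n : ℂ) + 1 + 1) ≠ 0 := by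
        have := Nat.cast_add_one_ne_zero (R := ℂ) (n + 1)
        simpa using this
      have := hcoef n
      have h3 : taylorCoeff F (n + 1) = ((if n = 0 then 0 else taylorCoeff U (n - 1)) -
          w * taylorCoeff U n) / ((n : ℂ) + 1) := by
        rw [← this]; field_simp
      rw [h3]
      simp only [he, Nat.add_eq_zero_iff, one_ne_zero, and_false, ↓reduceIte, Nat.add_sub_cancel,
        Nat.cast_add, Nat.cast_one]
      split_ifs
      · field_simp
        ring
      · field_simp
        ring)
  set G : ℂ → ℂ := fun z => (F z - c) / (z - w) with hG
  have hGd : DifferentiableOn ℂ G (ball 0 1) :=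
    (hF.sub_const c).div (by fun_prop) fun z hz => sub_ne_zero_of_mem_ball hw hz
  have hfac : ∀ z ∈ ball (0 : ℂ) 1, F z = c + (z - w) * G z := fun z hz => by
    rw [hG, mul_div_cancel₀ _ (sub_ne_zero_of_mem_ball hw hz)]; ring
  have hGc : ∀ n, taylorCoeff F n = (if n = 0 then c else 0) +
      ((if n = 0 then 0 else taylorCoeff G (n - 1)) - w * taylorCoeff G n) := by
    intro n
    refine congrFun (eq_of_hasSum_pow (F := F) (b := fun n => (if n = 0 then c else 0) +
      ((if n = 0 then 0 else taylorCoeff G (n - 1)) - w * taylorCoeff G n))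
      (fun z hz => hasSum_taylorCoeff hF hz) fun z hz => ?_) n
    rw [hfac z hz]
    have h1 := hasSum_sub_mul w (fun z hz => hasSum_taylorCoeff hGd hz) hz
    have h2 : HasSum (fun n => (if n = 0 then c else 0) * z ^ n) c := by
      refine hasSum_of_eq (hasSum_ite_eq 0 c) (fun n => ?_) rfl
      split_ifs with h <;> simp [h]
    exact hasSum_of_eq (h2.add h1) (fun n => by ring) rfl
  -- Up to a unimodular factor the coefficients of G are the tails of ∑ b n, so their square
  -- summability puts G in H².
  have htail : ∀ N, c - ∑ n ∈ Finset.range (N + 1), taylorCoeff F n * w ^ n =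
      w ^ (N + 1) * taylorCoeff G N := by
    intro N
    induction N with
    | zero => simp [hGc 0]
    | succ N ih =>
      rw [Finset.sum_range_succ, ← sub_sub, ih, hGc (N + 1)]
      simp only [Nat.add_eq_zero_iff, one_ne_zero, and_false, ↓reduceIte, Nat.add_sub_cancel]
      ring
  refine ⟨c, G, hGd, ?_, hfac, ?_⟩
  · simpa only [htail, norm_mul, norm_pow, hw, one_pow, one_mul] using hcs
  -- Abel's limit theorem: the boundary series converges to c, hence so do the radial values.
  · have h1 := Complex.tendsto_tsum_powerSeries_nhdsWithin_lt hc
    rw [tendsto_map'_iff] at h1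
    refine h1.congr' ?_
    filter_upwards [Ioo_mem_nhdsLT (zero_lt_one' ℝ)] with r hr
    have hz : (r : ℂ) * w ∈ ball (0 : ℂ) 1 := by simp [hw, abs_of_pos hr.1, hr.2]
    rw [← (hasSum_taylorCoeff hF hz).tsum_eq]
    refine tsum_congr fun n => ?_
    ring

/-! ### Products -/

lemma extendZero_mul (f g : UnitDisc → ℂ) : extendZero (f * g) = extendZero f * extendZero g := by
  funext z
  by_cases h : ‖z‖ < 1 <;> simp [extendZero, h]

/-- The value 0 off the disc keeps the bound on the whole plane, as `lintegral_mul_sq_lt_top`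
requires. -/
lemma norm_extendZero_le {f : UnitDisc → ℂ} {C : ℝ} (hf : ∀ z, ‖f z‖ ≤ C) (hC : 0 ≤ C) (z : ℂ) :
    ‖extendZero f z‖ ≤ C := by
  unfold extendZero
  split_ifs
  · exact hf _
  · simpa using hC

lemma IsAnalytic.mul {f g : UnitDisc → ℂ} (hf : IsAnalytic f) (hg : IsAnalytic g) :
    IsAnalytic (f * g) := by
  unfold IsAnalytic
  rw [extendZero_mul]
  exact DifferentiableOn.mul hf hg

lemma derivative_mul {f g : UnitDisc → ℂ} (hf : IsAnalytic f) (hg : IsAnalytic g) {z : ℂ}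
    (hz : z ∈ ball (0 : ℂ) 1) :
    derivative (f * g) z = derivative f z * extendZero g z + extendZero f z * derivative g z := by
  unfold derivative
  rw [extendZero_mul]
  exact deriv_mul (DifferentiableOn.differentiableAt hf (isOpen_ball.mem_nhds hz))
    (DifferentiableOn.differentiableAt hg (isOpen_ball.mem_nhds hz))

lemma circleAverage_mul_le {F G : ℂ → ℂ} (hF : ContinuousOn F (ball 0 1))
    (hG : ContinuousOn G (ball 0 1)) {C : ℝ} (hC : ∀ z, ‖F z‖ ≤ C) {r : ℝ}
    (hr : r ∈ Set.Ioo (0 : ℝ) 1) :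
    Real.circleAverage (fun z => ‖(F * G) z‖ ^ 2) 0 r ≤
      C ^ 2 * Real.circleAverage (fun z => ‖G z‖ ^ 2) 0 r := by
  have hsub : sphere (0 : ℂ) r ⊆ ball 0 1 := fun z hz => by
    simp only [mem_sphere_iff_norm, sub_zero] at hz
    simp [hz, hr.2]
  have hi := (((hG.mono hsub).norm.pow 2)).circleIntegrable hr.1.le
  rw [← smul_eq_mul (C ^ 2), ← Real.circleAverage_smul]
  apply Real.circleAverage_mono
  · exact ((((hF.mul hG).mono hsub).norm.pow 2)).circleIntegrable hr.1.le
  · exact hi.const_smul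
  · intro z _
    simp only [Pi.mul_apply, norm_mul, mul_pow, Pi.smul_apply, smul_eq_mul]
    gcongr
    exact hC z

lemma IsHardyTwo.mul_of_bounded {f g : UnitDisc → ℂ} (hf : IsAnalytic f) (hg : IsHardyTwo g)
    {C : ℝ} (hC : ∀ z, ‖f z‖ ≤ C) : IsHardyTwo (f * g) := by
  obtain ⟨hg, B, hB⟩ := hg
  have hC0 : 0 ≤ C := (norm_nonneg _).trans (hC 0)
  refine ⟨hf.mul hg, C ^ 2 * B, fun r hr => ?_⟩
  rw [extendZero_mul]
  refine (circleAverage_mul_le (DifferentiableOn.continuousOn hf)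
    (DifferentiableOn.continuousOn hg) (norm_extendZero_le hC hC0) hr).trans ?_
  gcongr
  exact hB r hr

lemma IsHardyTwo.summable {f : UnitDisc → ℂ} (hf : IsHardyTwo f) :
    Summable (fun n => ‖taylorCoeff (extendZero f) n‖ ^ 2) := by
  obtain ⟨C, hC⟩ := hf.2
  exact summable_of_circleAverage_le (fun z hz => hasSum_taylorCoeff hf.1 hz) hC

lemma summable_taylorCoeff_mul {F G : ℂ → ℂ} (hF : DifferentiableOn ℂ F (ball 0 1))
    (hG : DifferentiableOn ℂ G (ball 0 1)) {C : ℝ} (hC : ∀ z, ‖F z‖ ≤ C)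
    (hs : Summable (fun n => ‖taylorCoeff G n‖ ^ 2)) :
    Summable (fun n => ‖taylorCoeff (F * G) n‖ ^ 2) := by
  refine summable_of_circleAverage_le (C := C ^ 2 * ∑' n, ‖taylorCoeff G n‖ ^ 2)
    (fun z hz => hasSum_taylorCoeff (hF.mul hG) hz) fun r hr => ?_
  refine (circleAverage_mul_le hF.continuousOn hG.continuousOn hC hr).trans ?_
  gcongr
  exact circleAverage_le_of_summable (fun z hz => hasSum_taylorCoeff hG hz) hs hr

lemma dirichletIntegral_lt_top_iff (μ : Measure Circle) (f : UnitDisc → ℂ) :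
    dirichletIntegral μ f < ⊤ ↔
      ∫⁻ z in ball (0 : ℂ) 1, ‖derivative f z‖ₑ ^ 2 * poissonWeight μ z < ⊤ := by
  unfold dirichletIntegral
  constructor
  · intro h
    by_contra h'
    rw [not_lt_top_iff.1 h', ENNReal.mul_top (by simp)] at h
    exact lt_irrefl _ h
  · intro h
    exact ENNReal.mul_lt_top (by simpa using Real.pi_pos) h

lemma poissonWeight_dirac (ζ : Circle) (z : ℂ) : poissonWeight (Measure.dirac ζ) z =
    ENNReal.ofReal ((1 - ‖z‖ ^ 2) / ‖(ζ : ℂ) - z‖ ^ 2) := by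
  unfold poissonWeight
  rw [lintegral_dirac]

lemma lintegral_add_sq_lt_top {A B : ℂ → ℂ} {W : ℂ → ENNReal} {S : Set ℂ}
    (hm : AEMeasurable (fun z => ‖A z‖ₑ ^ 2 * W z) (volume.restrict S))
    (hA : ∫⁻ z in S, ‖A z‖ₑ ^ 2 * W z < ⊤) (hB : ∫⁻ z in S, ‖B z‖ₑ ^ 2 * W z < ⊤) :
    ∫⁻ z in S, ‖A z + B z‖ₑ ^ 2 * W z < ⊤ := by
  calc _ ≤ ∫⁻ z in S, (2 * (‖A z‖ₑ ^ 2 * W z) + 2 * (‖B z‖ₑ ^ 2 * W z)) := by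
        apply lintegral_mono
        intro z
        simp only [← mul_assoc, ← add_mul]
        gcongr
        exact enorm_add_sq_le _ _
    _ = 2 * (∫⁻ z in S, ‖A z‖ₑ ^ 2 * W z) + 2 * ∫⁻ z in S, ‖B z‖ₑ ^ 2 * W z := by
        rw [lintegral_add_left' (hm.const_mul 2), lintegral_const_mul' _ _ (by simp),
          lintegral_const_mul' _ _ (by simp)]
    _ < ⊤ := ENNReal.add_lt_top.2
        ⟨ENNReal.mul_lt_top (by simp) hA, ENNReal.mul_lt_top (by simp) hB⟩

lemma lintegral_mul_sq_lt_top {A B : ℂ → ℂ} {W : ℂ → ENNReal} {S : Set ℂ} {C : ℝ}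
    (hA : ∀ z, ‖A z‖ ≤ C) (hB : ∫⁻ z in S, ‖B z‖ₑ ^ 2 * W z < ⊤) :
    ∫⁻ z in S, ‖A z * B z‖ₑ ^ 2 * W z < ⊤ := by
  have hA' : ∀ z, ‖A z‖ₑ ≤ ENNReal.ofReal C := fun z => by
    rw [← ofReal_norm]; exact ENNReal.ofReal_le_ofReal (hA z)
  calc _ ≤ ∫⁻ z in S, ENNReal.ofReal C ^ 2 * (‖B z‖ₑ ^ 2 * W z) := by
        apply lintegral_mono
        intro z
        simp only [enorm_mul, mul_pow, ← mul_assoc]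
        gcongr
        exact hA' z
    _ < ⊤ := by
        rw [lintegral_const_mul' _ _ (by simp)]
        exact ENNReal.mul_lt_top (by simp) hB

/-- Bounded functions in a Dirichlet type space form an algebra. -/
lemma mul_mem_dirichletSpace {μ : Measure Circle} {f g : UnitDisc → ℂ} {C B : ℝ}
    (hf : f ∈ dirichletSpace μ) (hg : g ∈ dirichletSpace μ)
    (hC : ∀ z, ‖f z‖ ≤ C) (hB : ∀ z, ‖g z‖ ≤ B) : f * g ∈ dirichletSpace μ := by
  have hC0 : 0 ≤ C := (norm_nonneg _).trans (hC 0)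
  have hB0 : 0 ≤ B := (norm_nonneg _).trans (hB 0)
  refine ⟨IsHardyTwo.mul_of_bounded hf.1.1 hg.1 hC, ?_⟩
  have h1 := (dirichletIntegral_lt_top_iff μ f).1 hf.2
  have h2 := (dirichletIntegral_lt_top_iff μ g).1 hg.2
  rw [dirichletIntegral_lt_top_iff]
  refine lt_of_eq_of_lt (setLIntegral_congr_fun isOpen_ball.measurableSet fun z hz => by
    rw [derivative_mul hf.1.1 hg.1.1 hz, add_comm, mul_comm (derivative f z)])
    (lintegral_add_sq_lt_top ?_ (lintegral_mul_sq_lt_top (norm_extendZero_le hC hC0) h2)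
      (lintegral_mul_sq_lt_top (norm_extendZero_le hB hB0) h1))
  have := (DifferentiableOn.continuousOn hf.1.1).aemeasurable (μ := volume)
    isOpen_ball.measurableSet
  simp only [enorm_mul, mul_pow, mul_assoc]
  exact (this.enorm.pow_const 2).mul (aemeasurable_weighted μ g)

/-- If `h ∈ D(δ_ζ)` has boundary value zero at `ζ`, then `φ h ∈ D(δ_ζ)` for all bounded `φ`. -/
lemma mul_mem_dirichletSpace_dirac {ζ : Circle} {φ h : UnitDisc → ℂ} {C : ℝ}
    (hφ : IsHardyTwo φ) (hC : ∀ z, ‖φ z‖ ≤ C) (hh : h ∈ dirichletSpace (Measure.dirac ζ))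
    (h0 : Tendsto (fun r : ℝ => extendZero h (r * ζ)) (𝓝[<] 1) (𝓝 0)) :
    φ * h ∈ dirichletSpace (Measure.dirac ζ) := by
  have hC0 : 0 ≤ C := (norm_nonneg _).trans (hC 0)
  have hb := norm_extendZero_le hC hC0
  refine ⟨IsHardyTwo.mul_of_bounded hφ.1 hh.1 hC, ?_⟩
  have hI := (dirichletIntegral_lt_top_iff _ h).1 hh.2
  rw [dirichletIntegral_lt_top_iff]
  simp only [poissonWeight_dirac] at hI ⊢
  obtain ⟨c, G, hG, hGs, hfac, hc⟩ := exists_local_factor hh.1.1 (Circle.norm_coe ζ) hI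
  -- The constant in the factorization is the radial limit 0, so h = (z - ζ)G.
  obtain rfl := tendsto_nhds_unique hc h0
  have hmφ := (DifferentiableOn.continuousOn hφ.1).aemeasurable (μ := volume)
    isOpen_ball.measurableSet
  have hw : Measurable fun z : ℂ => ENNReal.ofReal (1 - ‖z‖ ^ 2) := by fun_prop
  have hw' : Measurable fun z : ℂ => ENNReal.ofReal ((1 - ‖z‖ ^ 2) / ‖(ζ : ℂ) - z‖ ^ 2) := by
    fun_prop
  -- Write φ'G = (φG)' - φG'. Both φG and G are in H², so Littlewood–Paley bounds each term.
  have hφG : ∫⁻ z in ball (0 : ℂ) 1,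
      ‖derivative φ z * G z‖ₑ ^ 2 * ENNReal.ofReal (1 - ‖z‖ ^ 2) < ⊤ := by
    have h1 := lintegral_deriv_lt_top (DifferentiableOn.mul hφ.1 hG)
      (fun z hz => hasSum_taylorCoeff (DifferentiableOn.mul hφ.1 hG) hz)
      (summable_taylorCoeff_mul hφ.1 hG hb hGs)
    have h2 := lintegral_mul_sq_lt_top (A := -extendZero φ) (fun z => by simpa using hb z)
      (lintegral_deriv_lt_top hG (fun z hz => hasSum_taylorCoeff hG hz) hGs)
    refine lt_of_eq_of_lt (setLIntegral_congr_fun isOpen_ball.measurableSet fun z hz => ?_)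
      (lintegral_add_sq_lt_top ?_ h1 h2)
    · have := deriv_mul (DifferentiableOn.differentiableAt hφ.1 (isOpen_ball.mem_nhds hz))
        (hG.differentiableAt (isOpen_ball.mem_nhds hz))
      rw [this]
      simp [derivative]
    · exact (((measurable_deriv _).enorm.pow_const 2).mul hw).aemeasurable
  refine lt_of_eq_of_lt (setLIntegral_congr_fun isOpen_ball.measurableSet fun z hz => by
    rw [derivative_mul hφ.1 hh.1.1 hz, add_comm])
    (lintegral_add_sq_lt_top ?_ (lintegral_mul_sq_lt_top hb hI) ?_)
  · simp only [enorm_mul, mul_pow, mul_assoc]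
    exact (hmφ.enorm.pow_const 2).mul
      (((measurable_derivative h).enorm.pow_const 2).mul hw').aemeasurable
  -- In φ'h = φ'(z - ζ)G the factor z - ζ cancels |ζ - z|² in the weight.
  · refine lt_of_eq_of_lt (setLIntegral_congr_fun isOpen_ball.measurableSet fun z hz => ?_) hφG
    have hz' := sub_ne_zero_of_mem_ball (Circle.norm_coe ζ) hz
    rw [← enorm_div_sub_sq hz', hfac z hz, zero_add]
    congr 3
    field_simp

/-! ### Multipliers are bounded -/

/-- The function on the disc with given Taylor coefficients. -/
def seriesFun (a : ℕ → ℂ) : UnitDisc → ℂ := fun z => ∑' n, a n * (z : ℂ) ^ n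

lemma extendZero_seriesFun (a : ℕ → ℂ) {z : ℂ} (hz : z ∈ ball (0 : ℂ) 1) :
    extendZero (seriesFun a) z = ∑' n, a n * z ^ n := by
  rw [extendZero_eq (by simpa using hz)]
  rfl

lemma isAnalytic_seriesFun {a : ℕ → ℂ} {C : ℝ} (ha : ∀ n, ‖a n‖ ≤ C) :
    IsAnalytic (seriesFun a) :=
  (differentiableOn_tsum_pow ha).congr fun _ hz => extendZero_seriesFun a hz

lemma hasSum_seriesFun {a : ℕ → ℂ} {C : ℝ} (ha : ∀ n, ‖a n‖ ≤ C) {z : ℂ}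
    (hz : z ∈ ball (0 : ℂ) 1) :
    HasSum (fun n => a n * z ^ n) (extendZero (seriesFun a) z) := by
  rw [extendZero_seriesFun a hz]
  exact (summable_mul_pow ha hz).hasSum

lemma taylorCoeff_seriesFun {a : ℕ → ℂ} {C : ℝ} (ha : ∀ n, ‖a n‖ ≤ C) :
    taylorCoeff (extendZero (seriesFun a)) = a :=
  eq_of_hasSum_pow (fun _ hz => hasSum_taylorCoeff (isAnalytic_seriesFun ha) hz)
    fun _ hz => hasSum_seriesFun ha hz

lemma seriesFun_taylorCoeff {f : UnitDisc → ℂ} (hf : IsAnalytic f) :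
    seriesFun (taylorCoeff (extendZero f)) = f := by
  funext z
  have hz : (z : ℂ) ∈ ball (0 : ℂ) 1 := by simpa using z.norm_lt_one
  have := (hasSum_taylorCoeff hf hz).tsum_eq
  rw [extendZero_eq z.norm_lt_one] at this
  exact this

lemma norm_seriesFun_le {a : ℕ → ℂ} {C : ℝ} (ha : ∀ n, ‖a n‖ ≤ C) (z : UnitDisc) :
    ‖seriesFun a z‖ ≤ (1 - ‖(z : ℂ)‖)⁻¹ * C := by
  have hs := (hasSum_geometric_of_lt_one (norm_nonneg _) z.norm_lt_one).mul_right C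
  refine tsum_of_norm_bounded hs fun n => ?_
  rw [norm_mul, norm_pow, mul_comm]
  gcongr
  exact ha n

lemma norm_derivative_seriesFun_le {a : ℕ → ℂ} {C : ℝ} (ha : ∀ n, ‖a n‖ ≤ C) {z : ℂ}
    (hz : z ∈ ball (0 : ℂ) 1) :
    ‖derivative (seriesFun a) z‖ ≤ (∑' n : ℕ, ((n : ℝ) + 1) * ‖z‖ ^ n) * C := by
  have hz' : ‖z‖ < 1 := by simpa using hz
  have hd := (isAnalytic_seriesFun ha).deriv isOpen_ball
  have hs : Summable (fun n : ℕ => ((n : ℝ) + 1) * ‖z‖ ^ n) := by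
    have h1 := summable_pow_mul_geometric_of_norm_lt_one 1 (r := ‖z‖) (by simpa using hz')
    have h2 := summable_geometric_of_lt_one (norm_nonneg z) hz'
    refine (h1.add h2).congr fun n => ?_
    ring
  have h := hasSum_taylorCoeff hd hz
  rw [derivative, ← h.tsum_eq]
  refine tsum_of_norm_bounded (hs.hasSum.mul_right C) fun n => ?_
  have hn : ‖(n : ℂ) + 1‖ = n + 1 := by
    rw [← Nat.cast_succ, Complex.norm_natCast]; simp
  rw [taylorCoeff_deriv, taylorCoeff_seriesFun ha, norm_mul, norm_mul, norm_pow, hn]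
  have := ha (n + 1)
  calc ((n : ℝ) + 1) * ‖a (n + 1)‖ * ‖z‖ ^ n ≤ ((n : ℝ) + 1) * C * ‖z‖ ^ n := by gcongr
    _ = _ := by ring

/-! ### A complete model of D(μ). -/

/-- Area measure on the disc weighted by `φ_μ`. -/
def weightedArea (μ : Measure Circle) : Measure ℂ :=
  (volume.restrict (ball 0 1)).withDensity (poissonWeight μ)

lemma ae_weightedArea_mem_ball (μ : Measure Circle) :
    ∀ᵐ z ∂weightedArea μ, z ∈ ball (0 : ℂ) 1 :=
  (withDensity_absolutelyContinuous _ _).ae_le (ae_restrict_mem isOpen_ball.measurableSet)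

lemma aemeasurable_poissonWeight (μ : Measure Circle) :
    AEMeasurable (poissonWeight μ) (volume.restrict (ball 0 1)) := by
  by_cases h : μ Set.univ = ⊤
  -- For infinite μ the weight is identically ⊤ on the disc, so no Fubini argument is needed.
  · refine ⟨fun _ => ⊤, measurable_const, ?_⟩
    filter_upwards [ae_restrict_mem isOpen_ball.measurableSet] with z hz
    exact poissonWeight_eq_top μ h (by simpa using hz)
  · have : IsFiniteMeasure μ := ⟨lt_top_iff_ne_top.2 h⟩
    exact (measurable_poissonWeight μ).aemeasurable

lemma memLp_derivative_iff (μ : Measure Circle) (f : UnitDisc → ℂ) :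
    MemLp (derivative f) 2 (weightedArea μ) ↔ dirichletIntegral μ f < ⊤ := by
  have hm := (measurable_derivative f).aestronglyMeasurable (μ := weightedArea μ)
  have h1 : ∫⁻ z, ‖derivative f z‖ₑ ^ 2 ∂weightedArea μ =
      ∫⁻ z in ball (0 : ℂ) 1, ‖derivative f z‖ₑ ^ 2 * poissonWeight μ z := by
    rw [weightedArea, lintegral_withDensity_eq_lintegral_mul₀ (aemeasurable_poissonWeight μ)
      ((measurable_derivative f).enorm.pow_const 2).aemeasurable]
    refine lintegral_congr fun z => ?_
    rw [Pi.mul_apply, mul_comm]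
  rw [dirichletIntegral_lt_top_iff, ← h1, MemLp, and_iff_right hm,
    eLpNorm_lt_top_iff_lintegral_rpow_enorm_lt_top (by simp) (by simp)]
  simp

/-- The sequence space `ℓ²`. -/
abbrev ellTwo : Type := lp (fun _ : ℕ => ℂ) 2

lemma ellTwo_norm_apply_le (a : ellTwo) (n : ℕ) : ‖a n‖ ≤ ‖a‖ :=
  lp.norm_apply_le_norm (by simp) a n

lemma seriesFun_add (a b : ellTwo) :
    seriesFun (⇑(a + b)) = seriesFun a + seriesFun b := by
  funext z
  have hz : (z : ℂ) ∈ ball (0 : ℂ) 1 := by simpa using z.norm_lt_one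
  simp only [seriesFun, Pi.add_apply, lp.coeFn_add, add_mul]
  exact (summable_mul_pow (ellTwo_norm_apply_le a) hz).tsum_add
    (summable_mul_pow (ellTwo_norm_apply_le b) hz)

lemma seriesFun_smul (c : ℂ) (a : ellTwo) :
    seriesFun (⇑(c • a)) = c • seriesFun a := by
  funext z
  simp only [seriesFun, Pi.smul_apply, lp.coeFn_smul, smul_eq_mul, mul_assoc]
  exact tsum_mul_left

lemma derivative_smul (c : ℂ) (f : UnitDisc → ℂ) (z : ℂ) :
    derivative (c • f) z = c * derivative f z := by
  unfold derivative
  rw [extendZero_smul, deriv_const_smul_field]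
  rfl

/-- A model of `D(μ)` inside a Banach space: the pairs of the coefficient sequence of `f` and
the derivative of `f`. -/
def graphSpace (μ : Measure Circle) : Submodule ℂ (ellTwo × Lp ℂ 2 (weightedArea μ)) where
  carrier := {p | p.2 =ᵐ[weightedArea μ] derivative (seriesFun p.1)}
  add_mem' := by
    intro p q hp hq
    simp only [Set.mem_ofPred_eq] at hp hq ⊢
    filter_upwards [hp, hq, Lp.coeFn_add p.2 q.2, ae_weightedArea_mem_ball μ]
      with z h1 h2 h3 hz
    rw [Prod.snd_add, h3, Pi.add_apply, h1, h2, Prod.fst_add, seriesFun_add, derivative_add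
      (isAnalytic_seriesFun (ellTwo_norm_apply_le _))
      (isAnalytic_seriesFun (ellTwo_norm_apply_le _)) hz]
  zero_mem' := by
    simp only [Set.mem_ofPred_eq]
    have h0 : seriesFun (⇑(0 : ellTwo)) = 0 := by
      funext z; simp [seriesFun]
    filter_upwards [Lp.coeFn_zero ℂ 2 (weightedArea μ)] with z h1
    rw [Prod.snd_zero, h1, Prod.fst_zero, h0]
    simp [derivative, extendZero_zero]
  smul_mem' := by
    intro c p hp
    simp only [Set.mem_ofPred_eq] at hp ⊢
    filter_upwards [hp, Lp.coeFn_smul c p.2] with z h1 h2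
    rw [Prod.smul_snd, h2, Pi.smul_apply, h1, Prod.smul_fst, seriesFun_smul, derivative_smul,
      smul_eq_mul]

lemma tendsto_derivative_seriesFun {u : ℕ → ellTwo} {a : ellTwo} (hu : Tendsto u atTop (𝓝 a))
    {z : ℂ} (hz : z ∈ ball (0 : ℂ) 1) :
    Tendsto (fun k => derivative (seriesFun (u k)) z) atTop
      (𝓝 (derivative (seriesFun a) z)) := by
  rw [tendsto_iff_norm_sub_tendsto_zero] at hu ⊢
  refine squeeze_zero (fun k => norm_nonneg _) (fun k => ?_)
    (by simpa using hu.const_mul (∑' n : ℕ, ((n : ℝ) + 1) * ‖z‖ ^ n))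
  have h : seriesFun (u k) = seriesFun (⇑(u k - a)) + seriesFun a := by
    rw [← seriesFun_add, sub_add_cancel]
  rw [h, derivative_add (isAnalytic_seriesFun (ellTwo_norm_apply_le _))
      (isAnalytic_seriesFun (ellTwo_norm_apply_le _)) hz, add_sub_cancel_right]
  exact norm_derivative_seriesFun_le (ellTwo_norm_apply_le _) hz

/-- Convergence in ℓ² forces pointwise convergence of the derivatives in the disc, while L²
convergence gives a.e. convergence of a subsequence; the two limits agree. Closedness makes the
model a Banach space. -/
lemma isClosed_graphSpace (μ : Measure Circle) :
    IsClosed (graphSpace μ : Set (ellTwo × Lp ℂ 2 (weightedArea μ))) := by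
  refine IsSeqClosed.isClosed ?_
  intro u p hu hup
  have h1 := (continuous_fst.tendsto p).comp hup
  have h2 := (continuous_snd.tendsto p).comp hup
  obtain ⟨ns, hns, hae⟩ := (tendstoInMeasure_of_tendsto_Lp h2).exists_seq_tendsto_ae
  have hall : ∀ᵐ z ∂weightedArea μ, ∀ k, (u k).2 z = derivative (seriesFun (u k).1) z :=
    ae_all_iff.2 hu
  change p.2 =ᵐ[weightedArea μ] derivative (seriesFun p.1)
  filter_upwards [hae, hall, ae_weightedArea_mem_ball μ] with z ha hk hz
  refine tendsto_nhds_unique ha ?_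
  have := (tendsto_derivative_seriesFun h1 hz).comp hns.tendsto_atTop
  refine this.congr fun k => ?_
  simp [hk]

lemma seriesFun_mem_dirichletSpace {μ : Measure Circle} (x : graphSpace μ) :
    seriesFun x.1.1 ∈ dirichletSpace μ := by
  have hb := ellTwo_norm_apply_le x.1.1
  refine ⟨⟨isAnalytic_seriesFun hb, ∑' n, ‖x.1.1 n‖ ^ 2, fun r hr => ?_⟩, ?_⟩
  · refine circleAverage_le_of_summable (fun z hz => hasSum_seriesFun hb hz) ?_ hr
    have := (lp.memℓp x.1.1).summable (by simp)
    simpa using this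
  · rw [← memLp_derivative_iff]
    exact (memLp_congr_ae x.2).1 (Lp.memLp x.1.2)

/-- The function on the disc represented by an element of the model. -/
def graphSpaceMap (μ : Measure Circle) : graphSpace μ →ₗ[ℂ] dirichletSpace μ where
  toFun x := ⟨seriesFun x.1.1, seriesFun_mem_dirichletSpace x⟩
  map_add' x y := Subtype.ext (seriesFun_add x.1.1 y.1.1)
  map_smul' c x := Subtype.ext (seriesFun_smul c x.1.1)

lemma graphSpaceMap_bijective (μ : Measure Circle) : Function.Bijective (graphSpaceMap μ) := by
  constructor
  · intro x y hxy
    have h : seriesFun x.1.1 = seriesFun y.1.1 := congrArg Subtype.val hxy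
    have h1 : x.1.1 = y.1.1 := by
      apply lp.ext
      rw [← taylorCoeff_seriesFun (ellTwo_norm_apply_le x.1.1), h,
        taylorCoeff_seriesFun (ellTwo_norm_apply_le y.1.1)]
    have h2 : x.1.2 = y.1.2 := by
      apply Lp.ext
      have hx : x.1.2 =ᵐ[weightedArea μ] derivative (seriesFun x.1.1) := x.2
      have hy : y.1.2 =ᵐ[weightedArea μ] derivative (seriesFun y.1.1) := y.2
      rw [h] at hx
      exact hx.trans hy.symm
    exact Subtype.ext (Prod.ext h1 h2)
  · intro f
    have ha : Memℓp (taylorCoeff (extendZero (f : UnitDisc → ℂ))) 2 := by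
      refine memℓp_gen ?_
      simpa using f.2.1.summable
    have hd := (memLp_derivative_iff μ f).2 f.2.2
    have hs : seriesFun (⇑(⟨_, ha⟩ : ellTwo)) = f := seriesFun_taylorCoeff f.2.1.1
    refine ⟨⟨(⟨_, ha⟩, hd.toLp _), ?_⟩, Subtype.ext hs⟩
    change hd.toLp _ =ᵐ[weightedArea μ] derivative (seriesFun (⇑(⟨_, ha⟩ : ellTwo)))
    rw [hs]
    exact hd.coeFn_toLp

/-- The identification of the model with `D(μ)`. -/
def graphSpaceEquiv (μ : Measure Circle) : graphSpace μ ≃ₗ[ℂ] dirichletSpace μ :=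
  LinearEquiv.ofBijective _ (graphSpaceMap_bijective μ)

lemma norm_graphSpaceEquiv_le {μ : Measure Circle} (x : graphSpace μ) (z : UnitDisc) :
    ‖(graphSpaceEquiv μ x : UnitDisc → ℂ) z‖ ≤ (1 - ‖(z : ℂ)‖)⁻¹ * ‖x‖ := by
  have h0 : 0 ≤ (1 - ‖(z : ℂ)‖)⁻¹ := inv_nonneg.2 (by linarith [z.norm_lt_one])
  refine (norm_seriesFun_le (ellTwo_norm_apply_le x.1.1) z).trans ?_
  gcongr
  exact norm_fst_le x.1

/-- Evaluation at a point of the disc is a continuous functional on `D(μ)`. -/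
def graphSpaceEval (μ : Measure Circle) (z : UnitDisc) : graphSpace μ →L[ℂ] ℂ :=
  LinearMap.mkContinuous
    { toFun := fun x => (graphSpaceEquiv μ x : UnitDisc → ℂ) z
      map_add' := fun x y => by simp
      map_smul' := fun c x => by simp }
    _ (fun x => norm_graphSpaceEquiv_le x z)

lemma one_mem_dirichletSpace (μ : Measure Circle) : (1 : UnitDisc → ℂ) ∈ dirichletSpace μ := by
  have h1 : ∀ z ∈ ball (0 : ℂ) 1, extendZero (1 : UnitDisc → ℂ) z = 1 := fun z hz => by
    rw [extendZero_eq (by simpa using hz)]; rfl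
  refine ⟨⟨(differentiableOn_const (1 : ℂ)).congr h1, 1, fun r hr => ?_⟩, ?_⟩
  · rw [Real.circleAverage_congr_sphere (f₂ := fun _ => 1), Real.circleAverage_const]
    intro z hz
    have : z ∈ ball (0 : ℂ) 1 := by
      simp only [mem_sphere_iff_norm, sub_zero] at hz
      simpa [hz, abs_of_pos hr.1] using hr.2
    simp [h1 z this]
  · rw [dirichletIntegral_lt_top_iff, setLIntegral_congr_fun isOpen_ball.measurableSet
      (g := fun _ => 0)]
    · simp
    · intro z hz
      have : derivative (1 : UnitDisc → ℂ) z = 0 := by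
        have he : extendZero (1 : UnitDisc → ℂ) =ᶠ[𝓝 z] fun _ => 1 := by
          filter_upwards [isOpen_ball.mem_nhds hz] with w hw using h1 w hw
        rw [derivative, he.deriv_eq, deriv_const]
      simp [this]

/-- Multipliers of a Dirichlet type space are bounded. -/
lemma exists_bound_of_mem_multipliers {μ : Measure Circle} {φ : UnitDisc → ℂ}
    (hφ : φ ∈ multipliers μ) : ∃ C, ∀ z, ‖φ z‖ ≤ C := by
  have : CompleteSpace (graphSpace μ) := (isClosed_graphSpace μ).completeSpace_coe
  let e := graphSpaceEquiv μ
  let m : dirichletSpace μ →ₗ[ℂ] dirichletSpace μ :=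
    { toFun := fun f => ⟨φ * f, hφ.2 f f.2⟩
      map_add' := fun f g => Subtype.ext (mul_add φ (f : UnitDisc → ℂ) g)
      map_smul' := fun c f => Subtype.ext (mul_smul_comm c φ (f : UnitDisc → ℂ)) }
  let T : graphSpace μ →ₗ[ℂ] graphSpace μ := e.symm.toLinearMap ∘ₗ m ∘ₗ e.toLinearMap
  have hT : ∀ x z, graphSpaceEval μ z (T x) = φ z * graphSpaceEval μ z x := by
    intro x z
    change (e (e.symm (m (e x))) : UnitDisc → ℂ) z = _
    rw [e.apply_symm_apply]
    rfl
  have hinj : ∀ x y : graphSpace μ,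
      (∀ z, graphSpaceEval μ z x = graphSpaceEval μ z y) → x = y := fun x y h =>
    e.injective (Subtype.ext (funext h))
  -- Closed graph theorem: point evaluations are continuous and separate points, and T multiplies
  -- each by the scalar φ z.
  have hcont : Continuous T := by
    refine T.continuous_of_seq_closed_graph fun u x y hu hTu => hinj _ _ fun z => ?_
    refine tendsto_nhds_unique (((graphSpaceEval μ z).continuous.tendsto y).comp hTu) ?_
    rw [hT]
    refine ((((graphSpaceEval μ z).continuous.tendsto x).comp hu).const_mul (φ z)).congr
      fun k => ?_
    simp [hT]
  let L : graphSpace μ →L[ℂ] graphSpace μ := ⟨T, hcont⟩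
  let x₀ := e.symm ⟨1, one_mem_dirichletSpace μ⟩
  -- Since L ^ n x₀ represents φ ^ n, the number |φ z| ^ n is at most a constant, depending on z,
  -- times B ^ n. Hence |φ z| ≤ B.
  have hpow : ∀ z n, graphSpaceEval μ z ((L ^ n) x₀) = φ z ^ n := by
    intro z n
    induction n with
    | zero =>
      change (e (e.symm _) : UnitDisc → ℂ) z = _
      rw [e.apply_symm_apply]
      simp
    | succ n ih =>
      rw [pow_succ', pow_succ', ← ih]
      exact hT _ z
  -- The maximum with 1 only ensures that B is positive.
  set B := max ‖L‖ 1 with hB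
  refine ⟨B, fun z => ?_⟩
  by_contra! hlt
  have hB0 : 0 < B := lt_of_lt_of_le one_pos (le_max_right _ _)
  have hL : ∀ n, ‖(L ^ n) x₀‖ ≤ B ^ n * ‖x₀‖ := by
    intro n
    induction n with
    | zero => simp
    | succ n ih =>
      rw [pow_succ', pow_succ', mul_assoc]
      exact (L.le_opNorm _).trans (mul_le_mul (le_max_left _ _) ih (norm_nonneg _) hB0.le)
  have h1 : 1 < ‖φ z‖ / B := (one_lt_div hB0).2 hlt
  have hbd : ∀ n, (‖φ z‖ / B) ^ n ≤ ‖graphSpaceEval μ z‖ * ‖x₀‖ := by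
    intro n
    rw [div_pow, div_le_iff₀ (by positivity), ← norm_pow, ← hpow]
    calc _ ≤ ‖graphSpaceEval μ z‖ * ‖(L ^ n) x₀‖ := ContinuousLinearMap.le_opNorm _ _
      _ ≤ ‖graphSpaceEval μ z‖ * (B ^ n * ‖x₀‖) := by
        gcongr
        exact hL n
      _ = _ := by ring
  obtain ⟨n, hn⟩ := ((tendsto_pow_atTop_atTop_of_one_lt h1).eventually_gt_atTop
    (‖graphSpaceEval μ z‖ * ‖x₀‖)).exists
  exact absurd (hbd n) (not_le.2 hn)

/-! ### Density of the disc -/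

lemma one_mem_multipliers (μ : Measure Circle) : (1 : UnitDisc → ℂ) ∈ multipliers μ :=
  ⟨one_mem_dirichletSpace μ, fun f hf => by rwa [one_mul]⟩

lemma one_mem_multipliersAddPoint (μ : Measure Circle) (ζ : Circle) :
    (1 : UnitDisc → ℂ) ∈ multipliersAddPoint μ ζ :=
  ⟨one_mem_multipliers μ, one_mem_dirichletSpace _⟩

lemma mul_mem_multipliers {μ : Measure Circle} {f g : UnitDisc → ℂ} (hf : f ∈ multipliers μ)
    (hg : g ∈ multipliers μ) : f * g ∈ multipliers μ :=
  ⟨hf.2 g hg.1, fun h hh => by rw [mul_assoc]; exact hf.2 _ (hg.2 h hh)⟩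

lemma mul_mem_multipliersAddPoint {μ : Measure Circle} {ζ : Circle} {f g : UnitDisc → ℂ}
    (hf : f ∈ multipliersAddPoint μ ζ) (hg : g ∈ multipliersAddPoint μ ζ) :
    f * g ∈ multipliersAddPoint μ ζ := by
  obtain ⟨C, hC⟩ := exists_bound_of_mem_multipliers hf.1
  obtain ⟨B, hB⟩ := exists_bound_of_mem_multipliers hg.1
  exact ⟨mul_mem_multipliers hf.1 hg.1, mul_mem_dirichletSpace hf.2 hg.2 hC hB⟩

/-- Functions in `D(δ_ζ)` have a radial limit at `ζ`. -/
lemma exists_radial_limit {ζ : Circle} {f : UnitDisc → ℂ}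
    (hf : f ∈ dirichletSpace (Measure.dirac ζ)) :
    ∃ c, Tendsto (fun r : ℝ => extendZero f (r * ζ)) (𝓝[<] 1) (𝓝 c) := by
  have hI := (dirichletIntegral_lt_top_iff _ f).1 hf.2
  simp only [poissonWeight_dirac] at hI
  obtain ⟨c, _, _, _, _, hc⟩ := exists_local_factor hf.1.1 (Circle.norm_coe ζ) hI
  exact ⟨c, hc⟩

/-- The functions in `H` vanishing at `ζ` form an ideal of `M(D(μ))`. -/
lemma mul_mem_multipliersAddPoint_of_vanishing {μ : Measure Circle} {ζ : Circle}
    {φ h : UnitDisc → ℂ} (hφ : φ ∈ multipliers μ) (hh : h ∈ multipliersAddPoint μ ζ)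
    (h0 : Tendsto (fun r : ℝ => extendZero h (r * ζ)) (𝓝[<] 1) (𝓝 0)) :
    h * φ ∈ multipliersAddPoint μ ζ := by
  obtain ⟨C, hC⟩ := exists_bound_of_mem_multipliers hφ
  refine ⟨mul_mem_multipliers hh.1 hφ, ?_⟩
  rw [mul_comm]
  exact mul_mem_dirichletSpace_dirac hφ.1.1 hC hh.2 h0

/-- Evaluation at a point of the disc. -/
def evaluation {A : Submodule ℂ (UnitDisc → ℂ)} (h1 : (1 : UnitDisc → ℂ) ∈ A) (z : UnitDisc) :
    MaximalIdealSpace A :=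
  ⟨LinearMap.proj z ∘ₗ A.subtype, fun h => one_ne_zero (α := ℂ) (by
    simpa using LinearMap.congr_fun h ⟨1, h1⟩), fun f g h hfg => by simp [hfg]⟩

lemma evaluation_mem {A : Submodule ℂ (UnitDisc → ℂ)} (h1 : (1 : UnitDisc → ℂ) ∈ A)
    (z : UnitDisc) : evaluation h1 z ∈ pointEvaluations A := ⟨z, fun _ => rfl⟩

lemma character_one {A : Submodule ℂ (UnitDisc → ℂ)} (h1 : (1 : UnitDisc → ℂ) ∈ A)
    (m : MaximalIdealSpace A) : m.1 ⟨1, h1⟩ = 1 := by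
  obtain ⟨f, hf⟩ : ∃ f, m.1 f ≠ 0 := by
    by_contra! h
    exact m.2.1 (LinearMap.ext h)
  have := m.2.2 ⟨1, h1⟩ f f (by simp)
  exact mul_right_cancel₀ hf (by rw [one_mul, ← this])

/-- The Gelfand topology is induced from the product A → ℂ, so closures can be computed there. -/
lemma mem_closure_pointEvaluations {A : Submodule ℂ (UnitDisc → ℂ)}
    (h1 : (1 : UnitDisc → ℂ) ∈ A) (m : MaximalIdealSpace A) :
    m ∈ closure (pointEvaluations A) ↔
      (fun f : A => m.1 f) ∈ closure (Set.range fun z : UnitDisc => fun f : A => f.1 z) := by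
  have h : (Set.range fun z : UnitDisc => fun f : A => f.1 z) =
      (fun (m : MaximalIdealSpace A) (f : A) => m.1 f) '' pointEvaluations A := by
    ext k
    constructor
    · rintro ⟨z, rfl⟩
      exact ⟨evaluation h1 z, evaluation_mem h1 z, rfl⟩
    · rintro ⟨m, ⟨z, hz⟩, rfl⟩
      exact ⟨z, funext fun f => (hz f).symm⟩
  rw [h]
  exact closure_induced

lemma norm_mul_circle_lt_one {r : ℝ} (hr : r ∈ Set.Ioo (0 : ℝ) 1) (ζ : Circle) :
    ‖(r : ℂ) * ζ‖ < 1 := by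
  rw [norm_mul, Circle.norm_coe, mul_one, Complex.norm_of_nonneg hr.1.le]
  exact hr.2

/-- A character given by radial limits at `ζ` is in the closure of the disc. -/
lemma mem_closure_of_radial_limit {A : Submodule ℂ (UnitDisc → ℂ)}
    (h1 : (1 : UnitDisc → ℂ) ∈ A) (m : MaximalIdealSpace A) (ζ : Circle)
    (hm : ∀ f : A, Tendsto (fun r : ℝ => extendZero f.1 (r * ζ)) (𝓝[<] 1) (𝓝 (m.1 f))) :
    m ∈ closure (pointEvaluations A) := by
  rw [mem_closure_pointEvaluations h1]
  refine mem_closure_of_tendsto (tendsto_pi_nhds.2 hm) ?_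
  filter_upwards [Ioo_mem_nhdsLT (zero_lt_one' ℝ)] with r hr
  have hz : ‖(r : ℂ) * ζ‖ < 1 := norm_mul_circle_lt_one hr ζ
  exact ⟨UnitDisc.mk _ hz, funext fun f => (extendZero_eq hz).symm⟩

/-- The restriction of a character in the closure of the disc is in the closure of the disc. -/
lemma mem_closure_of_restrict {A B : Submodule ℂ (UnitDisc → ℂ)} (hAB : A ≤ B)
    (h1 : (1 : UnitDisc → ℂ) ∈ A) (m : MaximalIdealSpace A) (k : MaximalIdealSpace B)
    (hk : ∀ f : A, k.1 ⟨f.1, hAB f.2⟩ = m.1 f) (hc : k ∈ closure (pointEvaluations B)) :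
    m ∈ closure (pointEvaluations A) := by
  rw [mem_closure_pointEvaluations (hAB h1)] at hc
  rw [mem_closure_pointEvaluations h1]
  let ρ : (B → ℂ) → (A → ℂ) := fun F f => F ⟨f.1, hAB f.2⟩
  have hρ : Continuous ρ := by fun_prop
  have hmem := image_closure_subset_closure_image hρ ⟨_, hc, rfl⟩
  have he : ρ (fun f => k.1 f) = fun f => m.1 f := funext hk
  rw [he, ← Set.range_comp] at hmem
  exact hmem

/-- A character of `A` not vanishing on an element `h` with `h B ⊆ A` extends to `B`. -/
lemma exists_extension {A B : Submodule ℂ (UnitDisc → ℂ)} (hAB : A ≤ B)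
    (hB : ∀ f ∈ B, ∀ g ∈ B, f * g ∈ B) (m : MaximalIdealSpace A) (h : A) (hm : m.1 h ≠ 0)
    (hA : ∀ f ∈ B, h.1 * f ∈ A) :
    ∃ k : MaximalIdealSpace B, ∀ f : A, k.1 ⟨f.1, hAB f.2⟩ = m.1 f := by
  let k : B →ₗ[ℂ] ℂ :=
    { toFun := fun f => (m.1 h)⁻¹ * m.1 ⟨h.1 * f.1, hA f.1 f.2⟩
      map_add' := fun f g => by
        rw [← mul_add, ← map_add]
        congr 2
        exact Subtype.ext (mul_add _ _ _)
      map_smul' := fun c f => by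
        rw [RingHom.id_apply, smul_eq_mul, mul_left_comm, ← smul_eq_mul c, ← map_smul]
        congr 2
        exact Subtype.ext (mul_smul_comm _ _ _) }
  have hk : ∀ f : A, k ⟨f.1, hAB f.2⟩ = m.1 f := fun f => by
    change (m.1 h)⁻¹ * m.1 ⟨h.1 * f.1, _⟩ = _
    rw [m.2.2 h f ⟨h.1 * f.1, hA f.1 (hAB f.2)⟩ rfl, inv_mul_cancel_left₀ hm]
  refine ⟨⟨k, fun h0 => hm ?_, fun f g fg hfg => ?_⟩, hk⟩
  · rw [← hk h, h0, LinearMap.zero_apply]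
  · change (m.1 h)⁻¹ * m.1 ⟨h.1 * fg.1, _⟩ =
      ((m.1 h)⁻¹ * m.1 ⟨h.1 * f.1, _⟩) * ((m.1 h)⁻¹ * m.1 ⟨h.1 * g.1, _⟩)
    have hfgA : (h.1 * f.1) * (h.1 * g.1) ∈ A := by
      rw [mul_assoc]
      refine hA _ (hB _ f.2 _ (hAB (hA _ g.2)))
    -- Multiplicativity of k: m(hf) m(hg) = m(hf · hg) = m(h) m(h · fg), then divide by m(h)².
    have e1 := m.2.2 ⟨h.1 * f.1, hA _ f.2⟩ ⟨h.1 * g.1, hA _ g.2⟩ ⟨_, hfgA⟩ rfl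
    have e2 := m.2.2 h ⟨h.1 * fg.1, hA _ fg.2⟩ ⟨_, hfgA⟩ (by
      change (h.1 * f.1) * (h.1 * g.1) = h.1 * (h.1 * fg.1)
      rw [hfg]; ring)
    rw [e1] at e2
    field_simp
    exact e2.symm

/-- The disc is dense in the maximal ideal space of `M(D(μ)) ∩ D(δ_ζ)` if it is dense in that of
`M(D(μ))`. -/
lemma discDense_multipliersAddPoint {μ : Measure Circle} (ζ : Circle)
    (hμ : DiscDense (multipliers μ)) : DiscDense (multipliersAddPoint μ ζ) := by
  intro m
  have h1 := one_mem_multipliersAddPoint μ ζ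
  have hle : multipliersAddPoint μ ζ ≤ multipliers μ := inf_le_left
  by_cases hI : ∃ h : multipliersAddPoint μ ζ,
      Tendsto (fun r : ℝ => extendZero h.1 (r * ζ)) (𝓝[<] 1) (𝓝 0) ∧ m.1 h ≠ 0
  · obtain ⟨h, h0, hm⟩ := hI
    obtain ⟨k, hk⟩ := exists_extension hle (fun f hf g hg => mul_mem_multipliers hf hg) m h hm
      fun f hf => mul_mem_multipliersAddPoint_of_vanishing hf h.2 h0
    exact mem_closure_of_restrict hle h1 m k hk (hμ k)
  · push Not at hI
    refine mem_closure_of_radial_limit h1 m ζ fun f => ?_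
    obtain ⟨c, hc⟩ := exists_radial_limit f.2.2
    suffices m.1 f = c by rwa [this]
    -- The function f - c has radial limit 0, so m kills it, and m(1) = 1 gives m(f) = c.
    have hz : m.1 (f - c • ⟨1, h1⟩) = 0 := by
      refine hI _ ?_
      have := hc.sub_const c
      rw [sub_self] at this
      refine this.congr' ?_
      filter_upwards [Ioo_mem_nhdsLT (zero_lt_one' ℝ)] with r hr
      have hz : ‖(r : ℂ) * ζ‖ < 1 := norm_mul_circle_lt_one hr ζ
      simp [extendZero_eq hz]
    rw [map_sub, map_smul, character_one, smul_eq_mul, mul_one, sub_eq_zero] at hz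
    exact hz

end DirichletType

end

theorem proposition2p7 (μ : MeasureTheory.Measure Circle) (ζ : Circle) (hζ : μ {ζ} = 0)
    (hμ : DirichletType.DiscDense (DirichletType.multipliers μ)) :
    (∀ f ∈ DirichletType.multipliersAddPoint μ ζ,
      ∀ g ∈ DirichletType.multipliersAddPoint μ ζ,
        f * g ∈ DirichletType.multipliersAddPoint μ ζ) ∧
    DirichletType.DiscDense (DirichletType.multipliersAddPoint μ ζ) :=
  ⟨fun _ hf _ hg => DirichletType.mul_mem_multipliersAddPoint hf hg,
    DirichletType.discDense_multipliersAddPoint ζ hμ⟩
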